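/- Call a linear differential operator $L=\sum_i a_i(x)\,\partial^i$ with $a_i\in\mathbb{K}[x]$ a *differential resolvent* of $P\in\mathbb{K}[x][y]$ ($\mathbb{K}$ a field of characteristic $0$) if $L\neq 0$ and $L$ has least order among the nonzero operators of this form that cancel all the roots of $P$ in an algebraic closure of $\mathbb{K}(x)$, on which $\partial$ acts as the unique $\mathbb{K}$-linear derivation with $\partial x=1$. **Theorem.** There is an absolute constant $C$ such that the following holds. Let $\mathbb{K}$ be a field of characteristic $0$, let $P\in\mathbb{K}[x][y]$ have degree at most $d_x$ in $x$ and at most $d_y$ in $y$, let $L$ be a differential resolvent of $P$, and let $\mathbb{F}$ be an extension field of $\mathbb{K}$ (for instance $\mathbb{K}$ itself or $\overline{\mathbb{K}}$). Then every nonzero Laurent series $y(x)\in\mathbb{F}((x))$ with $L(y)=0$ satisfies $$|\operatorname{val}_x(y(x))|\le C\,d_x\,d_y^2 .$$ -/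

import Mathlib

open Polynomial
open scoped LaurentSeries TensorProduct

noncomputable section

namespace Resolvent

/-- An algebraic closure of the field `K(x)`. -/
abbrev AlgFun (K : Type*) [Field K] : Type _ := AlgebraicClosure (RatFunc K)

instance (K : Type*) [Field K] [CharZero K] : CharZero (RatFunc K) :=
  charZero_of_injective_algebraMap (algebraMap K (RatFunc K)).injective

instance (K : Type*) [Field K] [CharZero K] : Algebra.FormallyEtale K[X] (AlgFun K) :=
  haveI : Algebra.FormallyEtale K[X] (RatFunc K) :=
    Algebra.FormallyEtale.of_isLocalization (nonZeroDivisors K[X])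
  haveI : Algebra.FormallyEtale (RatFunc K) (AlgFun K) :=
    Algebra.FormallyEtale.of_isSeparable _ _
  Algebra.FormallyEtale.comp K[X] (RatFunc K) (AlgFun K)

/-- The derivation `d/dx` on the algebraic closure of `K(x)`, for `K` of characteristic zero:
the unique `K`-linear derivation sending `x` to `1`. It is obtained by extending `d/dx` from
`K[x]` along the formally étale extension `K[x] → AlgFun K`. -/
def algDeriv (K : Type*) [Field K] [CharZero K] : Derivation K (AlgFun K) (AlgFun K) :=
  ((((mkDerivation K (1 : AlgFun K)).liftKaehlerDifferential.liftBaseChange (AlgFun K)).comp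
    (KaehlerDifferential.tensorKaehlerEquivOfFormallyEtale
      K K[X] (AlgFun K)).symm.toLinearMap).compDer (KaehlerDifferential.D K (AlgFun K)))

theorem algDeriv_algebraMap (K : Type*) [Field K] [CharZero K] (p : K[X]) :
    algDeriv K (algebraMap K[X] (AlgFun K) p) =
      algebraMap K[X] (AlgFun K) (derivative p) := by
  change (LinearMap.liftBaseChange (AlgFun K) _)
    ((KaehlerDifferential.tensorKaehlerEquivOfFormallyEtale K K[X] (AlgFun K)).symm
      (KaehlerDifferential.D K (AlgFun K) (algebraMap K[X] (AlgFun K) p))) = _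
  rw [KaehlerDifferential.tensorKaehlerEquivOfFormallyEtale_symm_D_algebraMap]
  simp [mkDerivation_apply, Algebra.smul_def]

/-- `algDeriv K` is the only `K`-linear derivation sending `x` to `1`. -/
theorem eq_algDeriv (K : Type*) [Field K] [CharZero K]
    (D : Derivation K (AlgFun K) (AlgFun K)) (hD : D (algebraMap K[X] (AlgFun K) X) = 1) :
    D = algDeriv K := by
  have hpoly : ∀ p : K[X], (D - algDeriv K) (algebraMap K[X] (AlgFun K) p) = 0 := by
    intro p
    have h : (D - algDeriv K).compAlgebraMap K[X] = 0 := by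
      apply Polynomial.derivation_ext
      change D (algebraMap K[X] (AlgFun K) X) - algDeriv K (algebraMap K[X] (AlgFun K) X) = 0
      rw [hD, algDeriv_algebraMap]
      simp
    exact congrArg (fun d : Derivation K K[X] (AlgFun K) => d p) h
  obtain ⟨G, hG⟩ : ∃ G, G = D - algDeriv K := ⟨_, rfl⟩
  rw [← hG] at hpoly
  let E : Derivation K[X] (AlgFun K) (AlgFun K) := Derivation.mk'
    { toFun := G
      map_add' := map_add G
      map_smul' := fun p f => by
        simp only [RingHom.id_apply, Algebra.smul_def]
        rw [Derivation.leibniz, hpoly, smul_zero, add_zero, smul_eq_mul] }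
    (fun a b => G.leibniz a b)
  have hE : E = 0 := by
    rw [← E.liftKaehlerDifferential_comp,
      Subsingleton.elim E.liftKaehlerDifferential 0]
    ext; simp
  have hG0 : G = 0 := by
    ext f
    exact congrArg (fun d : Derivation K[X] (AlgFun K) (AlgFun K) => d f) hE
  exact sub_eq_zero.mp (hG.symm.trans hG0)

/-- A linear differential operator `a₀ + a₁ ∂ + ⋯ + aₙ ∂ⁿ` with coefficients `aᵢ ∈ K[x]` is
encoded by the polynomial in `∂` with these coefficients; only the additive structure of
`K[x][∂]` is used. Its order is its degree in `∂`, and it acts on a `K[x]`-algebra equipped with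
a derivation `D` by `f ↦ ∑ aᵢ Dⁱ f`. -/
def applyOp {K A : Type*} [Field K] [Ring A] [Algebra K[X] A] (D : A → A) (L : K[X][X]) (f : A) :
    A :=
  L.sum fun i a => algebraMap K[X] A a * D^[i] f

/-- `L` cancels all the roots of `P ∈ K[x][y]` in the algebraic closure of `K(x)`. -/
def CancelsRoots {K : Type*} [Field K] [CharZero K] (L P : K[X][X]) : Prop :=
  ∀ y : AlgFun K, aeval y P = 0 → applyOp (algDeriv K) L y = 0

/-- `L` is a differential resolvent of `P`: a nonzero differential operator of least order among
those cancelling all the roots of `P`. It is unique up to a factor in `K(x)`. -/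
structure IsResolvent {K : Type*} [Field K] [CharZero K] (L P : K[X][X]) : Prop where
  ne_zero : L ≠ 0
  cancels : CancelsRoots L P
  order_le : ∀ M : K[X][X], M ≠ 0 → CancelsRoots M P → L.natDegree ≤ M.natDegree

/-- `y` is a solution of `L` in the field `F((x))`, with its derivation `d/dx`. -/
def IsLaurentSolution {K F : Type*} [Field K] [Field F] [Algebra K F] (L : K[X][X]) (y : F⸨X⸩) :
    Prop :=
  applyOp (LaurentSeries.hasseDeriv F 1 : F⸨X⸩ → F⸨X⸩) L y = 0

end Resolvent

end

/-! Replace `P` by its separable part `p`, of degree `n` in `y` and at most `d` in `x`, embed its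
roots `αᵢ` in an algebraic closure `E` of `F((x))`, and extend the `x`-adic valuation to `E`.
Constants of `E` are algebraic over `F`, so nonzero ones have valuation zero. If `L` has order `r`,
some Wronskian `W` of `r` roots is nonzero, and every solution is `y = ∑ c_b α_b` with constant
`c_b` (`exists_constant_combination`). Since `val αᵢ ≥ -d`, this gives `val y ≥ -d`.

For the other side, replace one root by `y` in `W`: this multiplies `W` by a nonzero constant.
Expanding along the row of `y`, whose entries have valuation at least `val y - (r - 1)`, bounds `val
y` in terms of `val W` and lower bounds for the complementary minors. Both must cost only `O(d n²)`,
whereas clearing denominators derivative by derivative would cost `O(d n³)`.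

The saving comes from lattices. Let `Λ` be the module of vectors `(q(αᵢ))ᵢ` with `deg q < n`. A
Sylvester-matrix count shows that a module containing `(αᵢ)` and `DΛ` exceeds `Λ` by dimension at
most `(2n - 1) d`, and each further derivation adds at most as much (`finrank_iterAddDeriv_le`). An
alternating map needs a denominator of degree only this dimension, whatever the number of its
arguments (`exists_smul_alternating_mem`), because repeated use of one new generator vanishes. This
bounds the minors of derivatives of roots (`SimpleRoots.valuation_rowMinor_le`).

To bound `val W` from above, compare it with a nonzero minor `G` of the coordinates of the
derivatives in the powers of `α`. This `G` is a rational function; applying the lattice argument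
also over `K[1/x]` controls its degree at infinity, hence the degree of its numerator
(`SimpleRoots.exists_interpMinor_eq`) and `val G`. Finally `G` is `W` times a determinant of
coordinates of constant vectors, controlled by Lagrange interpolation
(`SimpleRoots.one_le_valuation_wronskian`). -/

open Polynomial
open scoped LaurentSeries TensorProduct

noncomputable section

namespace Resolvent

/-! ### Dimension of cokernels of polynomial matrices. -/

section Cokernel

variable {K : Type*} [Field K]

/-- The cokernel of an injective square matrix over `K[X]` with entries of degree at most `d` has
dimension at most `d` times the size of the matrix. -/
theorem finrank_range_le_of_comp_eq_zero {κ₁ κ₂ : Type*} [Fintype κ₁] [Fintype κ₂]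
    (hcard : Fintype.card κ₂ ≤ Fintype.card κ₁) (d : ℕ)
    (f : (κ₁ → K[X]) →ₗ[K[X]] (κ₂ → K[X])) (hf : Function.Injective f)
    (hd : ∀ c : κ₁ → K[X], ∀ m, (∀ j, c j ∈ degreeLT K m) → ∀ i, f c i ∈ degreeLT K (m + d))
    {Z : Type*} [AddCommGroup Z] [Module K Z] (g : (κ₂ → K[X]) →ₗ[K] Z)
    (hg : ∀ c, g (f c) = 0) :
    Module.Finite K (LinearMap.range g) ∧
      Module.finrank K (LinearMap.range g) ≤ Fintype.card κ₂ * d := by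
  let inc (m : ℕ) : (κ₂ → degreeLT K m) →ₗ[K] (κ₂ → K[X]) :=
    LinearMap.pi fun i => (degreeLT K m).subtype ∘ₗ LinearMap.proj i
  let G (m : ℕ) : (κ₂ → degreeLT K m) →ₗ[K] Z := g ∘ₗ inc m
  have hfin (m : ℕ) : Module.Finite K (degreeLT K m) :=
    Module.Finite.equiv (degreeLTEquiv K m).symm
  have hrk (m : ℕ) : Module.finrank K (degreeLT K m) = m := by
    rw [(degreeLTEquiv K m).finrank_eq]; simp
  -- Vectors of degree below `m + d` form a space of dimension `card κ₂ * (m + d)`, and `f` puts a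
  -- subspace of dimension at least `card κ₂ * m` into the kernel; the difference does not depend on
  -- `m`.
  have hG (m : ℕ) : Module.finrank K (LinearMap.range (G (m + d))) ≤ Fintype.card κ₂ * d := by
    let fm : (κ₁ → degreeLT K m) →ₗ[K] (κ₂ → degreeLT K (m + d)) :=
      { toFun := fun c i => ⟨f (fun j => (c j : K[X])) i, hd _ m (fun j => (c j).2) i⟩
        map_add' := fun a b => by
          ext1 i; apply Subtype.ext
          exact congrFun (f.map_add (fun j => (a j : K[X])) (fun j => (b j : K[X]))) i
        map_smul' := fun r a => by
          ext1 i; apply Subtype.ext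
          exact congrFun ((f.restrictScalars K).map_smul r (fun j => (a j : K[X]))) i }
    have hinj : Function.Injective fm := by
      intro a b hab
      have : (fun j => (a j : K[X])) = fun j => (b j : K[X]) := by
        apply hf
        ext1 i
        exact congrArg Subtype.val (congrFun hab i)
      ext1 j; apply Subtype.ext; exact congrFun this j
    have hle : LinearMap.range fm ≤ LinearMap.ker (G (m + d)) := by
      rintro _ ⟨c, rfl⟩
      exact hg _
    have h1 := LinearMap.finrank_range_of_inj hinj
    have h2 := Submodule.finrank_mono hle
    have h3 := LinearMap.finrank_range_add_finrank_ker (G (m + d))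
    simp only [Module.finrank_pi_fintype, hrk, Finset.sum_const, Finset.card_univ,
      smul_eq_mul] at h1 h3
    have h4 : Fintype.card κ₂ * m ≤ Fintype.card κ₁ * m := Nat.mul_le_mul_right _ hcard
    rw [mul_add] at h3
    omega
  have hrank : Module.rank K (LinearMap.range g) ≤ (Fintype.card κ₂ * d : ℕ) := by
    apply rank_le
    intro s hs
    have hlift : ∀ z : LinearMap.range g, ∃ c, g c = z := fun z => z.2
    choose c hc using hlift
    -- Finitely many independent vectors lift to bounded degree, so the uniform bound `hG` applies
    -- to them.
    let m := s.sup fun z => Finset.univ.sup fun i => (c z i).natDegree + 1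
    have hmem : ∀ z ∈ s, ∀ i, c z i ∈ degreeLT K (m + d) := by
      intro z hz i
      rw [mem_degreeLT]
      refine lt_of_le_of_lt degree_le_natDegree ?_
      have h1 : (c z i).natDegree + 1 ≤ Finset.univ.sup fun i => (c z i).natDegree + 1 :=
        Finset.le_sup (f := fun i => (c z i).natDegree + 1) (Finset.mem_univ i)
      have h2 : _ ≤ m := Finset.le_sup
        (f := fun z => Finset.univ.sup fun i => (c z i).natDegree + 1) hz
      exact_mod_cast (by omega : (c z i).natDegree < m + d)
    have hs' : LinearIndependent K fun z : s => (⟨(z : LinearMap.range g), by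
        refine ⟨fun i => ⟨c z i, hmem z z.2 i⟩, ?_⟩
        exact hc z⟩ : LinearMap.range (G (m + d))) := by
      have h := hs.map' (LinearMap.range g).subtype (Submodule.ker_subtype _)
      refine LinearIndependent.of_comp (LinearMap.range (G (m + d))).subtype ?_
      exact h
    have := hs'.fintype_card_le_finrank
    rw [Fintype.card_coe] at this
    exact this.trans (hG m)
  have hF : Module.Finite K (LinearMap.range g) :=
    Module.rank_lt_aleph0_iff.mp (hrank.trans_lt (Cardinal.natCast_lt_aleph0))
  exact ⟨hF, Module.finrank_le_of_rank_le hrank⟩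

end Cokernel

/-! ### Denominators of alternating maps on an enlarged lattice. -/

section Alternating

variable {K : Type*} [Field K] {M W : Type*} [AddCommGroup M] [Module K[X] M]
  [AddCommGroup W] [Module K[X] W]

/-- Enlarging a `K[X]`-module by a vector killed by `f` modulo this module, one has to multiply
the values of an alternating map by `f` only once. -/
theorem smul_alternating_mem_of_sup_span (Λ : Submodule K[X] M) (z : M) (f : K[X])
    (hf : f • z ∈ Λ) (s : ℕ) (ω : M [⋀^Fin s]→ₗ[K[X]] W) (N : Submodule K[X] W)
    (hω : ∀ u : Fin s → M, (∀ a, u a ∈ Λ) → ω u ∈ N) (w : Fin s → M)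
    (hw : ∀ a, w a ∈ Λ ⊔ Submodule.span K[X] {z}) : f • ω w ∈ N := by
  have h : ∀ a, ∃ u ∈ Λ, ∃ c : K[X], u + c • z = w a := by
    intro a
    obtain ⟨u, hu, q, hq, h⟩ := Submodule.mem_sup.mp (hw a)
    obtain ⟨c, rfl⟩ := Submodule.mem_span_singleton.mp hq
    exact ⟨u, hu, c, h⟩
  choose u hu c hc using h
  have hw' : w = u + fun a => c a • z := by ext1 a; exact (hc a).symm
  rw [hw']
  have := ω.toMultilinearMap.map_add_univ u (fun a => c a • z)
  change f • ω.toMultilinearMap _ ∈ N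
  rw [this, Finset.smul_sum]
  refine Submodule.sum_mem _ fun t _ => ?_
  -- In the multilinear expansion, a term without `z` needs no factor; with one `z` the factor `f`
  -- is absorbed there; with two it vanishes by alternation.
  by_cases h0 : ∀ a, a ∈ t
  · refine N.smul_mem _ (hω _ fun a => ?_)
    rw [Finset.piecewise_eq_of_mem _ _ _ (h0 a)]
    exact hu a
  push Not at h0
  obtain ⟨a, ha⟩ := h0
  have hva : t.piecewise u (fun a => c a • z) =
      Function.update (t.piecewise u (fun a => c a • z)) a (c a • z) := by
    rw [eq_comm, Function.update_eq_self_iff, Finset.piecewise_eq_of_notMem _ _ _ ha]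
  rw [hva]
  change f • ω _ ∈ N
  rw [ω.map_update_smul, smul_comm, ← ω.map_update_smul]
  refine N.smul_mem _ ?_
  by_cases h1 : ∃ b, b ≠ a ∧ b ∉ t
  · obtain ⟨b, hba, hb⟩ := h1
    have hvb : Function.update (t.piecewise u (fun a => c a • z)) a (f • z) =
      Function.update (Function.update (t.piecewise u (fun a => c a • z)) a (f • z)) b
        (c b • z) := by
      rw [eq_comm, Function.update_eq_self_iff, Function.update_of_ne hba,
        Finset.piecewise_eq_of_notMem _ _ _ hb]
    rw [hvb, ω.map_update_smul, Function.update_comm hba.symm, ω.map_update_smul,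
      ω.map_eq_zero_of_eq _ (i := a) (j := b) _ hba.symm, smul_zero, smul_zero]
    · exact N.zero_mem
    · rw [Function.update_self, Function.update_of_ne hba, Function.update_self]
  · push Not at h1
    refine hω _ fun b => ?_
    by_cases hba : b = a
    · subst hba; rwa [Function.update_self]
    · rw [Function.update_of_ne hba, Finset.piecewise_eq_of_mem _ _ _ (h1 b hba)]
      exact hu b

variable [Module K M] [IsScalarTower K K[X] M]

theorem exists_ne_zero_smul_eq_zero_of_finite {Q : Type*} [AddCommGroup Q] [Module K[X] Q]
    [Module K Q] [IsScalarTower K K[X] Q] (z : Q)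
    [Module.Finite K (Submodule.span K[X] {z})] :
    ∃ f : K[X], f ≠ 0 ∧ f.natDegree ≤ Module.finrank K (Submodule.span K[X] {z}) ∧
      f • z = 0 := by
  set δ := Module.finrank K (Submodule.span K[X] {z})
  let g : degreeLT K (δ + 1) →ₗ[K] Submodule.span K[X] {z} :=
    { toFun := fun q => ⟨(q : K[X]) • z, Submodule.smul_mem _ _ (Submodule.mem_span_singleton_self z)⟩
      map_add' := fun a b => by apply Subtype.ext; simp [add_smul]
      map_smul' := fun r a => by apply Subtype.ext; simp }
  have : Module.Finite K (degreeLT K (δ + 1)) :=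
    Module.Finite.equiv (degreeLTEquiv K (δ + 1)).symm
  have hne : LinearMap.ker g ≠ ⊥ := by
    apply LinearMap.ker_ne_bot_of_finrank_lt
    rw [(degreeLTEquiv K (δ + 1)).finrank_eq]
    simp [δ]
  obtain ⟨q, hq, hq0⟩ := Submodule.exists_mem_ne_zero_of_ne_bot hne
  refine ⟨q, fun h => hq0 (Subtype.ext h), ?_, congrArg Subtype.val (LinearMap.mem_ker.mp hq)⟩
  have h := mem_degreeLT.mp q.2
  have hq1 : (q : K[X]) ≠ 0 := fun h => hq0 (Subtype.ext h)
  have h2 := (natDegree_lt_iff_degree_lt hq1).mpr h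
  omega

/-- If `S / Λ` has dimension at most `b`, some nonzero polynomial of degree at most `b` multiplies
the values on `S` of every alternating map into the module generated by the values on `Λ`. -/
theorem exists_smul_alternating_mem (b : ℕ) : ∀ (Λ S : Submodule K[X] M),
    Module.Finite K (S.map Λ.mkQ) → Module.finrank K (S.map Λ.mkQ) ≤ b →
    ∃ e : K[X], e ≠ 0 ∧ e.natDegree ≤ b ∧
      ∀ (s : ℕ) (ω : M [⋀^Fin s]→ₗ[K[X]] W) (N : Submodule K[X] W),
        (∀ u : Fin s → M, (∀ a, u a ∈ Λ) → ω u ∈ N) →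
        ∀ w : Fin s → M, (∀ a, w a ∈ S) → e • ω w ∈ N := by
  induction b using Nat.strong_induction_on with
  | _ b ih =>
  intro Λ S hfin hb
  by_cases hS : S ≤ Λ
  · refine ⟨1, one_ne_zero, by simp, fun s ω N hω w hw => ?_⟩
    rw [one_smul]
    exact hω w fun a => hS (hw a)
  obtain ⟨z, hzS, hzΛ⟩ := Set.not_subset.mp hS
  let z' : S.map Λ.mkQ := ⟨Λ.mkQ z, Submodule.mem_map_of_mem hzS⟩
  have hz' : z' ≠ 0 := by
    intro h
    exact hzΛ ((Submodule.Quotient.mk_eq_zero Λ).mp (congrArg Subtype.val h))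
  have hspan : Module.Finite K (Submodule.span K[X] {z'}) :=
    Module.Finite.of_injective ((Submodule.span K[X] {z'}).subtype.restrictScalars K)
      Subtype.val_injective
  obtain ⟨f, hf0, hfd, hfz⟩ := exists_ne_zero_smul_eq_zero_of_finite (K := K) z'
  set δ := Module.finrank K (Submodule.span K[X] {z'})
  have hfz' : f • z ∈ Λ :=
    (Submodule.Quotient.mk_eq_zero Λ).mp (congrArg Subtype.val hfz)
  have hδ : 0 < δ := by
    have : Nontrivial (Submodule.span K[X] {z'}) :=
      ⟨⟨⟨z', Submodule.mem_span_singleton_self z'⟩, 0, fun h => hz' (congrArg Subtype.val h)⟩⟩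
    exact Module.finrank_pos (R := K) (M := Submodule.span K[X] {z'})
  set Λ' := Λ ⊔ Submodule.span K[X] {z}
  let π : S.map Λ.mkQ →ₗ[K[X]] M ⧸ Λ' :=
    (Submodule.factor (le_sup_left : Λ ≤ Λ')) ∘ₗ (S.map Λ.mkQ).subtype
  have hπ : LinearMap.range π = S.map Λ'.mkQ := by
    rw [LinearMap.range_comp, Submodule.range_subtype, ← Submodule.map_comp]
    rfl
  have hker : Submodule.span K[X] {z'} ≤ LinearMap.ker π := by
    rw [Submodule.span_singleton_le_iff_mem, LinearMap.mem_ker]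
    change Submodule.factor (le_sup_left : Λ ≤ Λ') (Λ.mkQ z) = 0
    change Λ'.mkQ z = 0
    rw [Submodule.mkQ_apply, Submodule.Quotient.mk_eq_zero]
    exact Submodule.mem_sup_right (Submodule.mem_span_singleton_self z)
  have hdim : δ + Module.finrank K (S.map Λ'.mkQ) ≤ b := by
    have h1 := LinearMap.finrank_range_add_finrank_ker (π.restrictScalars K)
    have h2 : δ ≤ Module.finrank K (LinearMap.ker (π.restrictScalars K)) := by
      refine LinearMap.finrank_le_finrank_of_injective
        (f := (Submodule.inclusion hker).restrictScalars K) ?_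
      exact Submodule.inclusion_injective hker
    have h3 : Module.finrank K (LinearMap.range (π.restrictScalars K)) =
        Module.finrank K (S.map Λ'.mkQ) := by
      rw [← hπ]; rfl
    omega
  have hfin' : Module.Finite K (S.map Λ'.mkQ) := by
    rw [← hπ]
    exact Module.Finite.of_surjective (π.rangeRestrict.restrictScalars K)
      (LinearMap.surjective_rangeRestrict π)
  -- Adjoining `z` uses `δ` of the available dimension and costs a factor `f` of degree at most `δ`,
  -- so the degrees add up to at most `b`.
  obtain ⟨e, he0, hed, he⟩ := ih (b - δ) (by omega) Λ' S hfin' (by omega)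
  refine ⟨f * e, mul_ne_zero hf0 he0, ?_, fun s ω N hω w hw => ?_⟩
  · rw [natDegree_mul hf0 he0]
    omega
  · rw [mul_smul]
    have := he s ω (N.comap (LinearMap.lsmul K[X] W f)) (fun u hu => ?_) w hw
    · exact this
    · exact smul_alternating_mem_of_sup_span Λ z f hfz' s ω N hω u hu

end Alternating

/-! ### Lattices of values at the roots, and the Sylvester matrix of `p` and `p'`. -/

section EvalLattice

variable {K E ι : Type*} [Field K] [Field E] [Algebra K[X] E]

/-- The linear map sending `q ∈ K[x][y]` to the vector of the values `q(αᵢ) wᵢ`. -/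
def evalMul (α w : ι → E) : K[X][X] →ₗ[K[X]] (ι → E) :=
  LinearMap.pi fun i => (LinearMap.mulRight K[X] (w i)) ∘ₗ (aeval (α i)).toLinearMap

@[simp]
theorem evalMul_apply (α w : ι → E) (q : K[X][X]) (i : ι) :
    evalMul α w q i = aeval (α i) q * w i := rfl

/-- The `K[x]`-module of the vectors `q(αᵢ) wᵢ` with `q ∈ K[x][y]` of degree less than `m`. -/
def evalLattice (α w : ι → E) (m : ℕ) : Submodule K[X] (ι → E) :=
  (degreeLT K[X] m).map (evalMul α w)

/-- The polynomial of degree less than `m` with given coefficients. -/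
def ofCoeffs (R : Type*) [CommRing R] (m : ℕ) : (Fin m → R) →ₗ[R] R[X] :=
  (degreeLT R m).subtype ∘ₗ (degreeLTEquiv R m).symm.toLinearMap

theorem ofCoeffs_mem {R : Type*} [CommRing R] {m : ℕ} (c : Fin m → R) :
    ofCoeffs R m c ∈ degreeLT R m :=
  ((degreeLTEquiv R m).symm c).2

theorem ofCoeffs_coeff {R : Type*} [CommRing R] {m : ℕ} (c : Fin m → R) (j : Fin m) :
    (ofCoeffs R m c).coeff j = c j :=
  congrFun ((degreeLTEquiv R m).apply_symm_apply c) j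

theorem ofCoeffs_injective {R : Type*} [CommRing R] {m : ℕ} :
    Function.Injective (ofCoeffs R m) :=
  Subtype.val_injective.comp (degreeLTEquiv R m).symm.injective

theorem ofCoeffs_of_coeff {R : Type*} [CommRing R] {m : ℕ} {q : R[X]} (hq : q ∈ degreeLT R m) :
    ofCoeffs R m (fun j => q.coeff j) = q :=
  congrArg Subtype.val ((degreeLTEquiv R m).symm_apply_apply ⟨q, hq⟩)

theorem ofCoeffs_coeff_mem {m k : ℕ} {c : Fin m → K[X]} (hc : ∀ j, c j ∈ degreeLT K k) (i : ℕ) :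
    (ofCoeffs K[X] m c).coeff i ∈ degreeLT K k := by
  by_cases hi : i < m
  · exact ofCoeffs_coeff c ⟨i, hi⟩ ▸ hc ⟨i, hi⟩
  · rw [coeff_eq_zero_of_degree_lt]
    · exact Submodule.zero_mem _
    · exact (mem_degreeLT.mp (ofCoeffs_mem c)).trans_le (by exact_mod_cast not_lt.mp hi)

theorem coeff_mul_mem_degreeLT {d k : ℕ} {p q : K[X][X]} (hp : ∀ i, (p.coeff i).natDegree ≤ d)
    (hq : ∀ i, q.coeff i ∈ degreeLT K k) (i : ℕ) : (p * q).coeff i ∈ degreeLT K (k + d) := by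
  rw [coeff_mul]
  refine Submodule.sum_mem _ fun a _ => ?_
  by_cases h0 : q.coeff a.2 = 0
  · rw [h0, mul_zero]; exact Submodule.zero_mem _
  by_cases h1 : p.coeff a.1 = 0
  · rw [h1, zero_mul]; exact Submodule.zero_mem _
  rw [mem_degreeLT, ← natDegree_lt_iff_degree_lt (mul_ne_zero h1 h0), natDegree_mul h1 h0]
  have := (natDegree_lt_iff_degree_lt h0).mpr (mem_degreeLT.mp (hq a.2))
  have := hp a.1
  omega

theorem mul_mem_degreeLT {R : Type*} [CommRing R] [IsDomain R] {a b c : ℕ} {p q : R[X]}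
    (hp : p.natDegree ≤ a) (hq : q ∈ degreeLT R b) (h : a + b ≤ c) : p * q ∈ degreeLT R c := by
  by_cases h0 : q = 0
  · rw [h0, mul_zero]; exact Submodule.zero_mem _
  by_cases h1 : p = 0
  · rw [h1, zero_mul]; exact Submodule.zero_mem _
  rw [mem_degreeLT, ← natDegree_lt_iff_degree_lt (mul_ne_zero h1 h0), natDegree_mul h1 h0]
  have := (natDegree_lt_iff_degree_lt h0).mpr (mem_degreeLT.mp hq)
  omega

theorem natDegree_derivative_coeff_le {d : ℕ} {p : K[X][X]} (hp : ∀ i, (p.coeff i).natDegree ≤ d)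
    (i : ℕ) : ((derivative p).coeff i).natDegree ≤ d := by
  rw [coeff_derivative]
  refine natDegree_mul_le.trans ?_
  have h : ((i : K[X]) + 1).natDegree = 0 := by
    rw [← Nat.cast_succ]; exact natDegree_natCast _
  rw [h, add_zero]
  exact hp _

/-- A complete family of simple roots `αᵢ ∈ E` of a polynomial `p ∈ K[x][y]` with coefficients of
degree at most `d`. -/
structure SimpleRoots [Fintype ι] (p : K[X][X]) (d : ℕ) (α : ι → E) : Prop where
  algebraMap_injective : Function.Injective (algebraMap K[X] E)
  natDegree_coeff_le : ∀ i, (p.coeff i).natDegree ≤ d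
  injective : Function.Injective α
  card_eq : Fintype.card ι = p.natDegree
  ne_zero : p ≠ 0
  root : ∀ i, aeval (α i) p = 0

variable [Fintype ι] {p : K[X][X]} {d : ℕ} {α : ι → E}

theorem SimpleRoots.eq_zero_of_eval (h : SimpleRoots p d α) {q : E[X]}
    (hq : q.degree < p.natDegree) (hr : ∀ i, q.eval (α i) = 0) : q = 0 := by
  refine Polynomial.eq_zero_of_degree_lt_of_eval_index_eq_zero (s := Finset.univ)
    (v := α) h.injective.injOn ?_ (fun i _ => hr i)
  rwa [Finset.card_univ, h.card_eq]

theorem SimpleRoots.eq_zero_of_aeval (h : SimpleRoots p d α) {q : K[X][X]}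
    (hq : q ∈ degreeLT K[X] p.natDegree) (hr : ∀ i, aeval (α i) q = 0) : q = 0 := by
  refine (Polynomial.map_eq_zero_iff h.algebraMap_injective).mp (h.eq_zero_of_eval ?_ fun i => ?_)
  · exact degree_map_le.trans_lt (mem_degreeLT.mp hq)
  · rw [eval_map_algebraMap]; exact hr i

/-- The quotient of `p` by `y - αᵢ`. -/
def rootQuotient (p : K[X][X]) (a : E) : E[X] :=
  p.map (algebraMap K[X] E) /ₘ (X - C a)

theorem X_sub_C_mul_rootQuotient {a : E} (ha : aeval a p = 0) :
    (X - C a) * rootQuotient p a = p.map (algebraMap K[X] E) :=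
  mul_divByMonic_eq_iff_isRoot.mpr (by rw [IsRoot.def, eval_map_algebraMap, ha])

theorem SimpleRoots.degree_rootQuotient_lt (h : SimpleRoots p d α) (i : ι) :
    (rootQuotient p (α i)).degree < p.natDegree := by
  have hp : p.map (algebraMap K[X] E) ≠ 0 :=
    (Polynomial.map_ne_zero_iff h.algebraMap_injective).mpr h.ne_zero
  refine (degree_divByMonic_lt (p.map _) (q := X - C (α i)) hp ?_).trans_le ?_
  · rw [degree_X_sub_C]; exact zero_lt_one
  · exact degree_map_le.trans degree_le_natDegree

theorem SimpleRoots.eval_rootQuotient_ne (h : SimpleRoots p d α) {i j : ι} (hij : j ≠ i) :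
    (rootQuotient p (α i)).eval (α j) = 0 := by
  have h1 := congrArg (eval (α j)) (X_sub_C_mul_rootQuotient (h.root i))
  rw [eval_mul, eval_map_algebraMap, h.root j, eval_sub, eval_X, eval_C] at h1
  exact (mul_eq_zero.mp h1).resolve_left (sub_ne_zero.mpr fun h2 => hij (h.injective h2))

theorem SimpleRoots.eval_rootQuotient_self (h : SimpleRoots p d α) (i : ι) :
    (rootQuotient p (α i)).eval (α i) = aeval (α i) (derivative p) := by
  have h1 := congrArg (fun q => eval (α i) (derivative q)) (X_sub_C_mul_rootQuotient (h.root i))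
  simpa [derivative_map, eval_map_algebraMap] using h1

theorem SimpleRoots.aeval_derivative_ne_zero (h : SimpleRoots p d α) (i : ι) :
    aeval (α i) (derivative p) ≠ 0 := by
  intro h0
  have h1 : rootQuotient p (α i) = 0 := by
    refine h.eq_zero_of_eval (h.degree_rootQuotient_lt i) fun j => ?_
    by_cases hj : j = i
    · rw [hj, h.eval_rootQuotient_self, h0]
    · exact h.eval_rootQuotient_ne hj
  have h2 := X_sub_C_mul_rootQuotient (h.root i)
  rw [h1, mul_zero] at h2
  exact h.ne_zero ((Polynomial.map_eq_zero_iff h.algebraMap_injective).mp h2.symm)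

/-- The lattice of the vectors `q(αᵢ)` with `q` of degree less than that of `p`. -/
def baseLattice (p : K[X][X]) (α : ι → E) : Submodule K[X] (ι → E) :=
  evalLattice α (fun _ => 1) p.natDegree

/-- The lattice of the vectors `q(αᵢ) / p'(αᵢ)` with `q` of degree at most `2 deg p - 2`. -/
def derivLattice (p : K[X][X]) (α : ι → E) : Submodule K[X] (ι → E) :=
  evalLattice α (fun i => (aeval (α i) (derivative p))⁻¹) (2 * p.natDegree - 1)

variable [Algebra K E] [IsScalarTower K K[X] E]

-- The Sylvester map `(A, B) ↦ p A + p' B`, with `deg A < n - 1` and `deg B < n`, is a square matrix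
-- of size `2n - 1` with entries of degree at most `d`. It is injective because the roots are
-- simple, and its image dies in the quotient, since `(p A + p' B)(αᵢ) / p'(αᵢ) = B(αᵢ)`.
set_option maxHeartbeats 1000000 in
theorem SimpleRoots.finrank_derivLattice_le (h : SimpleRoots p d α) (hn : 0 < p.natDegree) :
    Module.Finite K ((derivLattice p α).map (baseLattice p α).mkQ) ∧
      Module.finrank K ((derivLattice p α).map (baseLattice p α).mkQ) ≤
        (2 * p.natDegree - 1) * d := by
  set n := p.natDegree with hn'
  let A : (Fin (n - 1) ⊕ Fin n → K[X]) →ₗ[K[X]] K[X][X] :=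
    ofCoeffs K[X] (n - 1) ∘ₗ LinearMap.funLeft K[X] K[X] Sum.inl
  let B : (Fin (n - 1) ⊕ Fin n → K[X]) →ₗ[K[X]] K[X][X] :=
    ofCoeffs K[X] n ∘ₗ LinearMap.funLeft K[X] K[X] Sum.inr
  let s : (Fin (n - 1) ⊕ Fin n → K[X]) →ₗ[K[X]] K[X][X] :=
    LinearMap.mulLeft K[X] p ∘ₗ A + LinearMap.mulLeft K[X] (derivative p) ∘ₗ B
  have hs (c) : s c = p * A c + derivative p * B c := rfl
  have hsmem (c) : s c ∈ degreeLT K[X] (2 * n - 1) := by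
    refine Submodule.add_mem _ ?_ ?_
    · exact mul_mem_degreeLT le_rfl (ofCoeffs_mem _) (by omega)
    · exact mul_mem_degreeLT (natDegree_derivative_le p) (ofCoeffs_mem _) (by omega)
  have haeval (c) (i : ι) : aeval (α i) (s c) = aeval (α i) (derivative p) * aeval (α i) (B c) := by
    rw [hs, map_add, map_mul, map_mul, h.root, zero_mul, zero_add]
  let f : (Fin (n - 1) ⊕ Fin n → K[X]) →ₗ[K[X]] (Fin (2 * n - 1) → K[X]) :=
    LinearMap.pi fun i => lcoeff K[X] i ∘ₗ s
  have hfs (c) : ofCoeffs K[X] (2 * n - 1) (f c) = s c := ofCoeffs_of_coeff (hsmem c)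
  have hinj : Function.Injective f := by
    rw [← LinearMap.ker_eq_bot, LinearMap.ker_eq_bot']
    intro c hc
    have h0 : s c = 0 := by rw [← hfs, hc, map_zero]
    have hB : B c = 0 := by
      refine h.eq_zero_of_aeval (ofCoeffs_mem _) fun i => ?_
      have := haeval c i
      rw [h0, map_zero] at this
      exact (mul_eq_zero.mp this.symm).resolve_left (h.aeval_derivative_ne_zero i)
    have hA : A c = 0 := by
      rw [hs, hB, mul_zero, add_zero] at h0
      exact (mul_eq_zero.mp h0).resolve_left h.ne_zero
    have hA' := ofCoeffs_injective (hA.trans (map_zero _).symm)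
    have hB' := ofCoeffs_injective (hB.trans (map_zero _).symm)
    ext1 j
    rcases j with j | j
    · exact congrFun hA' j
    · exact congrFun hB' j
  let g : (Fin (2 * n - 1) → K[X]) →ₗ[K[X]] (ι → E) ⧸ baseLattice p α :=
    (baseLattice p α).mkQ ∘ₗ evalMul α (fun i => (aeval (α i) (derivative p))⁻¹) ∘ₗ
      ofCoeffs K[X] (2 * n - 1)
  have hg (c) : g (f c) = 0 := by
    change (baseLattice p α).mkQ (evalMul α _ (ofCoeffs K[X] (2 * n - 1) (f c))) = 0
    rw [hfs, Submodule.mkQ_apply, Submodule.Quotient.mk_eq_zero]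
    refine ⟨B c, ofCoeffs_mem _, ?_⟩
    ext1 i
    rw [evalMul_apply, evalMul_apply, haeval, mul_one, mul_right_comm,
      mul_inv_cancel₀ (h.aeval_derivative_ne_zero i), one_mul]
  have hrange : LinearMap.range g = (derivLattice p α).map (baseLattice p α).mkQ := by
    rw [LinearMap.range_comp, LinearMap.range_comp, derivLattice, evalLattice]
    congr 2
    ext q
    exact ⟨fun ⟨c, hc⟩ => hc ▸ ofCoeffs_mem c, fun hq => ⟨_, ofCoeffs_of_coeff hq⟩⟩
  have key := finrank_range_le_of_comp_eq_zero (K := K) (by simp; omega) d f hinj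
    (fun c m hc i => ?_) (g.restrictScalars K) hg
  · rw [Fintype.card_fin] at key
    rw [← hrange]
    exact key
  · change (s c).coeff i ∈ _
    rw [hs, coeff_add]
    refine Submodule.add_mem _ ?_ ?_
    · exact coeff_mul_mem_degreeLT h.natDegree_coeff_le (ofCoeffs_coeff_mem fun j => hc _) i
    · exact coeff_mul_mem_degreeLT (natDegree_derivative_coeff_le h.natDegree_coeff_le)
        (ofCoeffs_coeff_mem fun j => hc _) i

end EvalLattice

/-! ### Growth of the lattice under derivation. -/

section DerivedLattices

variable {K E ι : Type*} [Field K] [Field E] [Algebra K[X] E] [Algebra K E]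
  [IsScalarTower K K[X] E]

/-- The chain rule, with `r` obtained from `q` by applying `δ` to its coefficients. Leaving `δ` free
allows both `d/dx` and its expression in the variable `1/x`. -/
theorem exists_derivation_aeval (D : Derivation K E E) (δ : K[X] → K[X])
    (hδ : ∀ f, D (algebraMap K[X] E f) = algebraMap K[X] E (δ f)) {m : ℕ} {q : K[X][X]}
    (hq : q ∈ degreeLT K[X] m) :
    ∃ r ∈ degreeLT K[X] m, ∀ a : E, D (aeval a q) = aeval a r + aeval a (derivative q) * D a := by
  refine ⟨∑ j ∈ Finset.range m, monomial j (δ (q.coeff j)), Submodule.sum_mem _ fun j hj => ?_,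
    fun a => ?_⟩
  · rw [mem_degreeLT]
    exact (degree_monomial_le _ _).trans_lt (by exact_mod_cast Finset.mem_range.mp hj)
  · have hsum : q = ∑ j ∈ Finset.range m, monomial j (q.coeff j) := by
      refine Polynomial.ext fun i => ?_
      simp only [finsetSum_coeff, coeff_monomial, Finset.sum_ite_eq', Finset.mem_range]
      split_ifs with h
      · rfl
      · exact coeff_eq_zero_of_degree_lt (n := i)
          ((mem_degreeLT.mp hq).trans_le (Nat.cast_le.mpr (not_lt.mp h)))
    conv_lhs => rw [hsum]
    conv_rhs => rw [hsum]
    simp only [map_sum, aeval_monomial, finsetSum_coeff, coeff_monomial, Finset.sum_ite_eq',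
      Finset.mem_range, Derivation.leibniz, hδ, derivative_monomial, Derivation.leibniz_pow]
    rw [Finset.sum_mul, ← Finset.sum_add_distrib]
    refine Finset.sum_congr rfl fun j hj => ?_
    rw [if_pos (Finset.mem_range.mp hj)]
    simp only [smul_eq_mul, nsmul_eq_mul, map_mul, map_natCast]
    ring

/-- A derivation acting on vectors componentwise. -/
def vecDeriv (ι : Type*) (D : Derivation K E E) : (ι → E) →ₗ[K] (ι → E) :=
  LinearMap.pi fun i => (D : E →ₗ[K] E) ∘ₗ LinearMap.proj i

@[simp]
theorem vecDeriv_apply (D : Derivation K E E) (z : ι → E) (i : ι) :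
    vecDeriv ι D z i = D (z i) := rfl

theorem vecDeriv_smul (D : Derivation K E E) {δ : K[X] → K[X]}
    (hδ : ∀ f, D (algebraMap K[X] E f) = algebraMap K[X] E (δ f)) (f : K[X]) (z : ι → E) :
    vecDeriv ι D (f • z) = f • vecDeriv ι D z + δ f • z := by
  ext1 i
  simp only [vecDeriv_apply, Pi.smul_apply, Pi.add_apply]
  simp only [Algebra.smul_def, Derivation.leibniz, hδ, Algebra.algebraMap_self, RingHom.id_apply]
  ring

/-- The module `S + D S`. -/
def addDeriv (D : Derivation K E E) (δ : K[X] → K[X])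
    (hδ : ∀ f, D (algebraMap K[X] E f) = algebraMap K[X] E (δ f))
    (S : Submodule K[X] (ι → E)) : Submodule K[X] (ι → E) where
  carrier := {z | ∃ a ∈ S, ∃ b ∈ S, z = a + vecDeriv ι D b}
  zero_mem' := ⟨0, S.zero_mem, 0, S.zero_mem, by rw [map_zero, add_zero]⟩
  add_mem' := by
    rintro _ _ ⟨a, ha, b, hb, rfl⟩ ⟨a', ha', b', hb', rfl⟩
    exact ⟨a + a', S.add_mem ha ha', b + b', S.add_mem hb hb', by rw [map_add]; abel⟩
  smul_mem' := by
    rintro f _ ⟨a, ha, b, hb, rfl⟩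
    refine ⟨f • a - δ f • b, S.sub_mem (S.smul_mem _ ha) (S.smul_mem _ hb), f • b,
      S.smul_mem _ hb, ?_⟩
    rw [vecDeriv_smul D hδ, smul_add]
    abel

theorem le_addDeriv (D : Derivation K E E) (δ : K[X] → K[X])
    (hδ : ∀ f, D (algebraMap K[X] E f) = algebraMap K[X] E (δ f))
    (S : Submodule K[X] (ι → E)) : S ≤ addDeriv D δ hδ S :=
  fun z hz => ⟨z, hz, 0, S.zero_mem, by rw [map_zero, add_zero]⟩

theorem vecDeriv_mem_addDeriv (D : Derivation K E E) (δ : K[X] → K[X])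
    (hδ : ∀ f, D (algebraMap K[X] E f) = algebraMap K[X] E (δ f))
    {S : Submodule K[X] (ι → E)} {z : ι → E} (hz : z ∈ S) :
    vecDeriv ι D z ∈ addDeriv D δ hδ S :=
  ⟨0, S.zero_mem, z, hz, by rw [zero_add]⟩

/-- The module generated by the derivatives of order at most `k` of the elements of `S`. -/
def iterAddDeriv (D : Derivation K E E) (δ : K[X] → K[X])
    (hδ : ∀ f, D (algebraMap K[X] E f) = algebraMap K[X] E (δ f))
    (S : Submodule K[X] (ι → E)) (k : ℕ) : Submodule K[X] (ι → E) :=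
  (addDeriv D δ hδ)^[k] S

theorem iterAddDeriv_succ (D : Derivation K E E) (δ : K[X] → K[X])
    (hδ : ∀ f, D (algebraMap K[X] E f) = algebraMap K[X] E (δ f))
    (S : Submodule K[X] (ι → E)) (k : ℕ) :
    iterAddDeriv D δ hδ S (k + 1) = addDeriv D δ hδ (iterAddDeriv D δ hδ S k) :=
  Function.iterate_succ_apply' _ _ _

theorem iterAddDeriv_mono (D : Derivation K E E) (δ : K[X] → K[X])
    (hδ : ∀ f, D (algebraMap K[X] E f) = algebraMap K[X] E (δ f))
    (S : Submodule K[X] (ι → E)) : Monotone (iterAddDeriv D δ hδ S) :=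
  monotone_nat_of_le_succ fun k => by rw [iterAddDeriv_succ]; exact le_addDeriv _ _ _ _

theorem iterate_vecDeriv_mem (D : Derivation K E E) (δ : K[X] → K[X])
    (hδ : ∀ f, D (algebraMap K[X] E f) = algebraMap K[X] E (δ f))
    {S : Submodule K[X] (ι → E)} {z : ι → E} (hz : z ∈ S) (k : ℕ) :
    (vecDeriv ι D)^[k] z ∈ iterAddDeriv D δ hδ S k := by
  induction k with
  | zero => exact hz
  | succ k ih =>
    rw [Function.iterate_succ_apply', iterAddDeriv_succ]
    exact vecDeriv_mem_addDeriv _ _ _ ih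

theorem iterate_vecDeriv_apply (D : Derivation K E E) (z : ι → E) (k : ℕ) (i : ι) :
    (vecDeriv ι D)^[k] z i = D^[k] (z i) := by
  induction k with
  | zero => rfl
  | succ k ih => rw [Function.iterate_succ_apply', Function.iterate_succ_apply', vecDeriv_apply, ih]

/-- If `D Λ ≤ T`, each derivation step enlarges the lattice by at most `dim T / Λ`. -/
theorem finrank_iterAddDeriv_le (D : Derivation K E E) (δ : K[X] → K[X])
    (hδ : ∀ f, D (algebraMap K[X] E f) = algebraMap K[X] E (δ f))
    {Λ T : Submodule K[X] (ι → E)} (hD : ∀ z ∈ Λ, vecDeriv ι D z ∈ T) {b : ℕ}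
    (hfin : Module.Finite K (T.map Λ.mkQ)) (hb : Module.finrank K (T.map Λ.mkQ) ≤ b) (k : ℕ) :
    Module.Finite K ((iterAddDeriv D δ hδ T k).map Λ.mkQ) ∧
      Module.finrank K ((iterAddDeriv D δ hδ T k).map Λ.mkQ) ≤ (k + 1) * b := by
  -- `B` lifts `T / Λ`. It is only a `K`-subspace because `D` is `K`-linear but not `K[x]`-linear.
  obtain ⟨B, hBfin, hBb, hB⟩ : ∃ B : Submodule K (ι → E), Module.Finite K B ∧
      Module.finrank K B ≤ b ∧ ∀ z ∈ T, ∃ c ∈ B, z - c ∈ Λ := by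
    let g : T →ₗ[K] T.map Λ.mkQ := (Λ.mkQ.submoduleMap T).restrictScalars K
    obtain ⟨σ, hσ⟩ := LinearMap.exists_rightInverse_of_surjective g
      (LinearMap.range_eq_top.mpr (Λ.mkQ.submoduleMap_surjective T))
    refine ⟨LinearMap.range (T.subtype.restrictScalars K ∘ₗ σ), inferInstance,
      (LinearMap.finrank_range_le _).trans hb, fun z hz => ⟨_, ⟨g ⟨z, hz⟩, rfl⟩, ?_⟩⟩
    have h := congrArg Subtype.val (LinearMap.congr_fun hσ (g ⟨z, hz⟩))
    exact (Submodule.Quotient.eq Λ).mp h.symm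
  let Bk (k : ℕ) : Submodule K (ι → E) := B.map ((vecDeriv ι D) ^ k)
  -- Modulo the previous module, step `k + 1` adds only `D^(k+1) B`, of dimension at most `b`.
  have hstep (k : ℕ) : ∀ z ∈ iterAddDeriv D δ hδ T (k + 1),
      ∃ c ∈ Bk (k + 1), z - c ∈ iterAddDeriv D δ hδ T k := by
    have haux (k : ℕ) (c : ι → E) (hc : c ∈ Bk k) : vecDeriv ι D c ∈ Bk (k + 1) := by
      obtain ⟨c', hc', rfl⟩ := hc
      exact ⟨c', hc', by rw [pow_succ']; rfl⟩
    induction k with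
    | zero =>
      intro z hz
      rw [iterAddDeriv_succ] at hz
      obtain ⟨a, ha, u, hu, rfl⟩ := hz
      obtain ⟨c, hc, hcu⟩ := hB u hu
      refine ⟨vecDeriv ι D c, haux 0 c ⟨c, hc, rfl⟩, ?_⟩
      rw [add_sub_assoc, ← map_sub]
      exact T.add_mem ha (hD _ hcu)
    | succ k ih =>
      intro z hz
      rw [iterAddDeriv_succ] at hz
      obtain ⟨a, ha, u, hu, rfl⟩ := hz
      obtain ⟨c, hc, hcu⟩ := ih u hu
      refine ⟨vecDeriv ι D c, haux _ c hc, ?_⟩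
      rw [add_sub_assoc, ← map_sub]
      refine Submodule.add_mem _ ha ?_
      rw [iterAddDeriv_succ]
      exact vecDeriv_mem_addDeriv _ _ _ hcu
  have hBk (k : ℕ) : Module.finrank K (Bk k) ≤ b := (Submodule.finrank_map_le _ _).trans hBb
  obtain ⟨C, hCfin, hCb, hC⟩ : ∃ C : Submodule K (ι → E), Module.Finite K C ∧
      Module.finrank K C ≤ (k + 1) * b ∧ ∀ z ∈ iterAddDeriv D δ hδ T k, ∃ c ∈ C, z - c ∈ Λ := by
    induction k with
    | zero => exact ⟨B, hBfin, by simpa using hBb, hB⟩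
    | succ k ih =>
      obtain ⟨C, hCfin, hCb, hC⟩ := ih
      refine ⟨C ⊔ Bk (k + 1), inferInstance, ?_, fun z hz => ?_⟩
      · have := Submodule.finrank_add_le_finrank_add_finrank C (Bk (k + 1))
        have := hBk (k + 1)
        rw [add_mul _ 1, one_mul]
        omega
      · obtain ⟨c, hc, h1⟩ := hstep k z hz
        obtain ⟨c', hc', h2⟩ := hC _ h1
        exact ⟨c' + c, Submodule.add_mem_sup hc' hc, by rwa [add_comm, ← sub_sub]⟩
  have hle : ((iterAddDeriv D δ hδ T k).map Λ.mkQ).restrictScalars K ≤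
      C.map (Λ.mkQ.restrictScalars K) := by
    rintro _ ⟨z, hz, rfl⟩
    obtain ⟨c, hc, h⟩ := hC z hz
    exact ⟨c, hc, ((Submodule.Quotient.eq Λ).mpr h).symm⟩
  have hfin1 : Module.Finite K (C.map (Λ.mkQ.restrictScalars K)) := inferInstance
  refine ⟨?_, ?_⟩
  · exact Module.Finite.of_injective (Submodule.inclusion hle)
      (Submodule.inclusion_injective hle)
  · exact ((Submodule.finrank_mono hle).trans (Submodule.finrank_map_le _ _)).trans hCb

variable [Fintype ι] {p : K[X][X]} {d : ℕ} {α : ι → E}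

theorem SimpleRoots.mem_derivLattice (h : SimpleRoots p d α) {q : K[X][X]}
    (hq : q ∈ degreeLT K[X] (2 * p.natDegree - 1)) {z : ι → E}
    (hz : ∀ i, aeval (α i) (derivative p) * z i = aeval (α i) q) : z ∈ derivLattice p α := by
  refine ⟨q, hq, ?_⟩
  ext1 i
  rw [evalMul_apply, ← hz, mul_comm, inv_mul_cancel_left₀ (h.aeval_derivative_ne_zero i)]

/-- The numerator `y p'` has degree too large when `n = 1`; subtracting `n p` cancels the leading
term without changing values at the roots. -/
theorem SimpleRoots.mem_derivLattice_self (h : SimpleRoots p d α) (hn : 0 < p.natDegree) :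
    α ∈ derivLattice p α := by
  refine h.mem_derivLattice (q := X * derivative p - (p.natDegree : K[X]) • p) ?_ fun i => ?_
  · rw [mem_degreeLT]
    have h1 : (X * derivative p - (p.natDegree : K[X]) • p).degree < (p.natDegree : WithBot ℕ) := by
      rw [degree_lt_iff_coeff_zero]
      intro m hm
      rw [coeff_sub, coeff_smul, smul_eq_mul]
      rcases hm.eq_or_lt with hm | hm
      · subst hm
        rw [← Nat.sub_add_cancel hn, coeff_X_mul, coeff_derivative, Nat.sub_add_cancel hn,
          ← Nat.cast_one, ← Nat.cast_add, Nat.sub_add_cancel hn, mul_comm, sub_self]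
      · obtain ⟨m, rfl⟩ : ∃ k, m = k + 1 := ⟨m - 1, by omega⟩
        rw [coeff_X_mul, coeff_derivative, coeff_eq_zero_of_natDegree_lt hm, zero_mul, mul_zero,
          sub_zero]
    exact h1.trans_le (Nat.cast_le.mpr (by omega))
  · rw [map_sub, map_mul, aeval_X, map_smul, h.root, smul_zero, sub_zero, mul_comm]

/-- Differentiating `p(α) = 0` gives `p'(α) Dα = -p^δ(α)`, where `δ` acts on coefficients. Hence
`p'(α) D(q(α)) = (p' q^δ - p^δ q')(α)`, and both products have degree at most `2n - 2`. -/
theorem SimpleRoots.vecDeriv_mem_derivLattice (h : SimpleRoots p d α) (hn : 0 < p.natDegree)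
    (D : Derivation K E E) (δ : K[X] → K[X])
    (hδ : ∀ f, D (algebraMap K[X] E f) = algebraMap K[X] E (δ f)) :
    ∀ z ∈ baseLattice p α, vecDeriv ι D z ∈ derivLattice p α := by
  rintro _ ⟨q, hq, rfl⟩
  have hp : p ∈ degreeLT K[X] (p.natDegree + 1) := by
    rw [mem_degreeLT]
    exact degree_le_natDegree.trans_lt (by exact_mod_cast Nat.lt_succ_self _)
  obtain ⟨q', hq', hDq⟩ := exists_derivation_aeval D δ hδ hq
  obtain ⟨p', hp', hDp⟩ := exists_derivation_aeval D δ hδ hp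
  have hq2 : derivative q ∈ degreeLT K[X] (p.natDegree - 1) := by
    by_cases h0 : q = 0
    · rw [h0, derivative_zero]; exact Submodule.zero_mem _
    by_cases h1 : derivative q = 0
    · rw [h1]; exact Submodule.zero_mem _
    have h2 := (natDegree_lt_iff_degree_lt h0).mpr (mem_degreeLT.mp hq)
    have h3 : (derivative q).degree < q.degree := degree_derivative_lt h0
    have h4 := natDegree_lt_natDegree h1 h3
    rw [mem_degreeLT, ← natDegree_lt_iff_degree_lt h1]
    omega
  have hp2 : p'.natDegree ≤ p.natDegree := by
    by_cases h0 : p' = 0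
    · rw [h0, natDegree_zero]; exact Nat.zero_le _
    · have := (natDegree_lt_iff_degree_lt h0).mpr (mem_degreeLT.mp hp')
      omega
  refine h.mem_derivLattice (q := derivative p * q' - p' * derivative q) ?_ fun i => ?_
  · refine Submodule.sub_mem _ ?_ ?_
    · exact mul_mem_degreeLT (natDegree_derivative_le p) hq' (by omega)
    · exact mul_mem_degreeLT hp2 hq2 (by omega)
  · have h1 := hDp (α i)
    rw [h.root, map_zero] at h1
    rw [vecDeriv_apply, evalMul_apply, mul_one, hDq, map_sub, map_mul, map_mul]
    linear_combination (-(aeval (α i) (derivative q))) * h1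

/-- Up to a factor of degree at most `k (2 n - 1) d`, the values of an alternating map at the
derivatives of order less than `k` of the vector of the roots are generated by its values at vectors
of polynomials in the roots. -/
theorem SimpleRoots.exists_mul_alternating_mem (h : SimpleRoots p d α) (hn : 0 < p.natDegree)
    (D : Derivation K E E) (δ : K[X] → K[X])
    (hδ : ∀ f, D (algebraMap K[X] E f) = algebraMap K[X] E (δ f)) (k : ℕ) :
    ∃ e : K[X], e ≠ 0 ∧ e.natDegree ≤ k * ((2 * p.natDegree - 1) * d) ∧
      ∀ (s : ℕ) (ω : (ι → E) [⋀^Fin s]→ₗ[E] E) (N : AddSubgroup E),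
        (∀ f : K[X], ∀ z ∈ N, algebraMap K[X] E f * z ∈ N) →
        (∀ q : Fin s → K[X][X], (∀ a, q a ∈ degreeLT K[X] p.natDegree) →
          ω (fun a i => aeval (α i) (q a)) ∈ N) →
        ∀ j : Fin s → ℕ, (∀ a, j a < k) →
          algebraMap K[X] E e * ω (fun a i => D^[j a] (α i)) ∈ N := by
  rcases k with _ | k
  · refine ⟨1, one_ne_zero, by simp, fun s ω N _ hω j hj => ?_⟩
    rcases s with _ | s
    · rw [map_one, one_mul]
      convert hω (fun _ => 0) (fun a => a.elim0) using 2
    · exact absurd (hj 0) (Nat.not_lt_zero _)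
  obtain ⟨hfin, hle⟩ := h.finrank_derivLattice_le hn
  obtain ⟨hfin', hle'⟩ := finrank_iterAddDeriv_le D δ hδ
    (h.vecDeriv_mem_derivLattice hn D δ hδ) hfin hle k
  obtain ⟨e, he0, hed, he⟩ := exists_smul_alternating_mem (W := E) _ _ _ hfin' hle'
  refine ⟨e, he0, hed, fun s ω N hN hω j hj => ?_⟩
  let N' : Submodule K[X] E :=
    { N with smul_mem' := fun f z hz => by rw [Algebra.smul_def]; exact hN f z hz }
  have := he s { ω.toMultilinearMap.restrictScalars K[X] with
    map_eq_zero_of_eq' := ω.map_eq_zero_of_eq' } N' (fun u hu => ?_) (fun a => (vecDeriv ι D)^[j a] α)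
    (fun a => iterAddDeriv_mono D δ hδ _ (Nat.le_of_lt_succ (hj a))
      (iterate_vecDeriv_mem D δ hδ (h.mem_derivLattice_self hn) (j a)))
  · rw [Algebra.smul_def] at this
    have hv : (fun a i => D^[j a] (α i)) = fun a => (vecDeriv ι D)^[j a] α := by
      ext a i
      exact (iterate_vecDeriv_apply D α (j a) i).symm
    rw [hv]
    exact this
  · choose q hq hqu using hu
    have : u = fun a i => aeval (α i) (q a) := by
      ext a i
      rw [← hqu, evalMul_apply, mul_one]
    rw [this]
    exact hω q hq

/-- The inverse of `p'(α)` has a denominator of degree at most `(2 n - 1) d`. -/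
theorem SimpleRoots.exists_mul_inv_derivative (h : SimpleRoots p d α) (hn : 0 < p.natDegree) :
    ∃ e : K[X], e ≠ 0 ∧ e.natDegree ≤ (2 * p.natDegree - 1) * d ∧
      ∃ q ∈ degreeLT K[X] p.natDegree, ∀ i,
        algebraMap K[X] E e = aeval (α i) q * aeval (α i) (derivative p) := by
  obtain ⟨hfin, hle⟩ := h.finrank_derivLattice_le hn
  obtain ⟨e, he0, hed, he⟩ := exists_smul_alternating_mem (W := ι → E) _ _ _ hfin hle
  have h1 : (fun i => (aeval (α i) (derivative p))⁻¹) ∈ derivLattice p α := by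
    refine h.mem_derivLattice (q := 1) ?_ fun i => ?_
    · rw [mem_degreeLT, degree_one]
      exact_mod_cast (by omega)
    · rw [mul_inv_cancel₀ (h.aeval_derivative_ne_zero i), map_one]
  -- With one argument and the identity map, the statement on alternating maps says that `e`
  -- multiplies the larger lattice into the base lattice.
  obtain ⟨q, hq, hqe⟩ := he 1 (AlternatingMap.ofSubsingleton K[X] (ι → E) (ι → E) 0 LinearMap.id)
    (baseLattice p α) (fun u hu => hu 0) (fun _ => _) (fun _ => h1)
  refine ⟨e, he0, hed, q, hq, fun i => ?_⟩
  have h2 := congrFun hqe i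
  rw [evalMul_apply, mul_one] at h2
  rw [h2]
  change _ = (e • (aeval (α i) (derivative p))⁻¹) * _
  rw [Algebra.smul_def, inv_mul_cancel_right₀ (h.aeval_derivative_ne_zero i)]

end DerivedLattices

/-! ### Nonvanishing minors. -/

section Minors

/-- Linearly independent vectors over a field have a nonvanishing maximal minor. -/
theorem exists_det_ne_zero_of_linearIndependent {F ι : Type*} [Field F] [Fintype ι] {r : ℕ}
    {u : Fin r → ι → F} (hu : LinearIndependent F u) :
    ∃ J : Fin r → ι, (Matrix.of fun a b => u a (J b)).det ≠ 0 := by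
  let A : Matrix (Fin r) ι F := Matrix.of u
  have hrank : A.rank = r := by
    rw [LinearIndependent.rank_matrix (M := A) hu, Fintype.card_fin]
  rw [Matrix.rank_eq_finrank_span_cols] at hrank
  obtain ⟨f, hf, -, hli⟩ := Submodule.exists_fun_fin_finrank_span_eq F (Set.range A.col)
  choose J hJ using hf
  let J' : Fin r → ι := fun b => J (Fin.cast hrank.symm b)
  refine ⟨J', ?_⟩
  have h1 : LinearIndependent F (Matrix.of fun a b => u a (J' b)).col := by
    have h2 := hli.comp (Fin.cast hrank.symm) (Fin.cast_injective _)
    have h3 : f ∘ Fin.cast hrank.symm = (Matrix.of fun a b => u a (J' b)).col :=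
      funext fun b => (hJ _).symm
    rw [h3] at h2
    exact h2
  exact ((Matrix.isUnit_iff_isUnit_det _).mp
    (Matrix.linearIndependent_cols_iff_isUnit.mp h1)).ne_zero

theorem exists_det_ne_zero_of_linearIndependent_of_isDomain {R ι : Type*} [CommRing R] [IsDomain R]
    [Fintype ι] {r : ℕ} {u : Fin r → ι → R} (hu : LinearIndependent R u) :
    ∃ J : Fin r → ι, (Matrix.of fun a b => u a (J b)).det ≠ 0 := by
  let g : (ι → R) →ₗ[R] (ι → FractionRing R) :=
    LinearMap.pi fun i => Algebra.linearMap R (FractionRing R) ∘ₗ LinearMap.proj i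
  have hg : LinearMap.ker g = ⊥ := by
    rw [LinearMap.ker_eq_bot]
    intro a b h
    ext1 i
    exact IsFractionRing.injective R (FractionRing R) (congrFun h i)
  have h1 : LinearIndependent (FractionRing R) (g ∘ u) :=
    (LinearIndependent.iff_fractionRing R (FractionRing R)).mp (hu.map' g hg)
  obtain ⟨J, hJ⟩ := exists_det_ne_zero_of_linearIndependent h1
  refine ⟨J, fun h0 => hJ ?_⟩
  have := congrArg (algebraMap R (FractionRing R)) h0
  rw [RingHom.map_det, map_zero] at this
  exact this

end Minors

/-! ### The substitution `x ↦ 1/x`. -/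

section Reflection

variable {K E : Type*} [Field K] [Field E] [Algebra K E]

theorem aeval_inv_injective {ξ : E} (hξ : Function.Injective (aeval ξ : K[X] →ₐ[K] E)) :
    Function.Injective (aeval ξ⁻¹ : K[X] →ₐ[K] E) := by
  have hξ0 : ξ ≠ 0 := by
    intro h
    have : (X : K[X]) = 0 := hξ (by rw [aeval_X, map_zero, h])
    exact X_ne_zero this
  let : Invertible ξ := invertibleOfNonzero hξ0
  refine (injective_iff_map_eq_zero _).mpr fun f hf => ?_
  have h1 := eval₂_reflect_eq_zero_iff (algebraMap K E) ξ f.natDegree (reflect f.natDegree f) ?_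
  · rw [reflect_reflect, invOf_eq_inv] at h1
    have h2 : reflect f.natDegree f = 0 := hξ (by rw [map_zero]; exact h1.mp hf)
    rwa [reflect_eq_zero_iff] at h2
  · exact reverse_natDegree_le f

/-- The polynomial `x^d p(1/x, y)`. -/
def reflectCoeffs (d : ℕ) (p : K[X][X]) : K[X][X] :=
  ∑ i ∈ Finset.range (p.natDegree + 1), monomial i (reflect d (p.coeff i))

theorem reflectCoeffs_coeff (d : ℕ) (p : K[X][X]) (i : ℕ) :
    (reflectCoeffs d p).coeff i = reflect d (p.coeff i) := by
  simp only [reflectCoeffs, finsetSum_coeff, coeff_monomial, Finset.sum_ite_eq', Finset.mem_range]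
  split_ifs with h
  · rfl
  · rw [coeff_eq_zero_of_natDegree_lt (by omega), reflect_zero]

theorem natDegree_reflectCoeffs (d : ℕ) (p : K[X][X]) :
    (reflectCoeffs d p).natDegree = p.natDegree := by
  by_cases hp : p = 0
  · have : reflectCoeffs d p = 0 := by
      ext1 i; rw [reflectCoeffs_coeff, hp, coeff_zero, reflect_zero]
    rw [this, hp]
  refine natDegree_eq_of_le_of_coeff_ne_zero ?_ ?_
  · rw [natDegree_le_iff_coeff_eq_zero]
    intro i hi
    rw [reflectCoeffs_coeff, coeff_eq_zero_of_natDegree_lt hi, reflect_zero]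
  · rw [reflectCoeffs_coeff, Ne, reflect_eq_zero_iff]
    exact leadingCoeff_ne_zero.mpr hp

theorem natDegree_reflect_le' {d : ℕ} {f : K[X]} (hf : f.natDegree ≤ d) :
    (reflect d f).natDegree ≤ d :=
  natDegree_reflect_le.trans (max_le le_rfl hf)

theorem eval₂_reflectCoeffs {ξ : E} (hξ : ξ ≠ 0) {d : ℕ} {p : K[X][X]}
    (hp : ∀ i, (p.coeff i).natDegree ≤ d) (a : E) :
    eval₂ (aeval ξ⁻¹ : K[X] →ₐ[K] E).toRingHom a (reflectCoeffs d p) * ξ ^ d =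
      eval₂ (aeval ξ : K[X] →ₐ[K] E).toRingHom a p := by
  let : Invertible ξ := invertibleOfNonzero hξ
  rw [eval₂_eq_sum_range, eval₂_eq_sum_range, natDegree_reflectCoeffs, Finset.sum_mul]
  refine Finset.sum_congr rfl fun i _ => ?_
  rw [reflectCoeffs_coeff, mul_right_comm]
  congr 1
  have h := eval₂_reflect_mul_pow (algebraMap K E) ξ d (p.coeff i) (hp i)
  rw [invOf_eq_inv] at h
  exact h

/-- `SimpleRoots.exists_mul_alternating_mem` for the `K[x]`-algebra structure given by a
homomorphism. -/
theorem exists_mul_alternating_mem_of_algHom {ι : Type*} [Fintype ι] (φ : K[X] →ₐ[K] E)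
    (hφ : Function.Injective φ) {p : K[X][X]} {d : ℕ} {α : ι → E}
    (hd : ∀ i, (p.coeff i).natDegree ≤ d) (hα : Function.Injective α)
    (hcard : Fintype.card ι = p.natDegree) (hp : p ≠ 0)
    (hroot : ∀ i, eval₂ φ.toRingHom (α i) p = 0) (hn : 0 < p.natDegree)
    (D : Derivation K E E) (δ : K[X] → K[X]) (hδ : ∀ f, D (φ f) = φ (δ f)) (k : ℕ) :
    ∃ e : K[X], e ≠ 0 ∧ e.natDegree ≤ k * ((2 * p.natDegree - 1) * d) ∧
      ∀ (s : ℕ) (ω : (ι → E) [⋀^Fin s]→ₗ[E] E) (N : AddSubgroup E),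
        (∀ f : K[X], ∀ z ∈ N, φ f * z ∈ N) →
        (∀ q : Fin s → K[X][X], (∀ a, q a ∈ degreeLT K[X] p.natDegree) →
          ω (fun a i => eval₂ φ.toRingHom (α i) (q a)) ∈ N) →
        ∀ j : Fin s → ℕ, (∀ a, j a < k) →
          φ e * ω (fun a i => D^[j a] (α i)) ∈ N := by
  let := φ.toRingHom.toAlgebra
  have : IsScalarTower K K[X] E := IsScalarTower.of_algebraMap_eq fun x => (φ.commutes x).symm
  have h : SimpleRoots p d α := ⟨hφ, hd, hα, hcard, hp, hroot⟩
  exact h.exists_mul_alternating_mem hn D δ hδ k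

end Reflection

/-! ### Coordinates in the powers of the roots, and minors as alternating maps. -/

section Coordinates

variable {E ι : Type*} [Field E] [Fintype ι] [DecidableEq ι]

/-- The coefficient of `y^j` in the polynomial interpolating the values `z` at the nodes `α`. -/
def interpCoeff (α : ι → E) (j : ℕ) : (ι → E) →ₗ[E] E :=
  lcoeff E j ∘ₗ Lagrange.interpolate Finset.univ α

theorem interpCoeff_eval {α : ι → E} (hα : Function.Injective α) {q : E[X]}
    (hq : q.degree < Fintype.card ι) (j : ℕ) :
    interpCoeff α j (fun i => q.eval (α i)) = q.coeff j := by
  change (Lagrange.interpolate Finset.univ α _).coeff j = _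
  rw [← Lagrange.eq_interpolate hα.injOn (by rwa [Finset.card_univ])]

theorem eq_zero_of_interpCoeff_eq_zero {α : ι → E} (hα : Function.Injective α) {z : ι → E}
    (hz : ∀ j < Fintype.card ι, interpCoeff α j z = 0) : z = 0 := by
  have h2 := Lagrange.degree_interpolate_lt (v := α) (s := Finset.univ) z hα.injOn
  rw [Finset.card_univ] at h2
  have h3 : Lagrange.interpolate Finset.univ α z = 0 := by
    ext1 j
    rw [coeff_zero]
    by_cases hj : j < Fintype.card ι
    · exact hz j hj
    · exact coeff_eq_zero_of_degree_lt (h2.trans_le (Nat.cast_le.mpr (not_lt.mp hj)))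
  ext1 i
  rw [← Lagrange.eval_interpolate_at_node (v := α) z hα.injOn (Finset.mem_univ i), h3, eval_zero]
  rfl

/-- A minor of the coordinates of vectors with respect to the powers of `α`. -/
def interpMinor (α : ι → E) {s : ℕ} (J : Fin s → ℕ) : (ι → E) [⋀^Fin s]→ₗ[E] E :=
  Matrix.detRowAlternating.compLinearMap (LinearMap.pi fun b => interpCoeff α (J b))

theorem interpMinor_apply (α : ι → E) {s : ℕ} (J : Fin s → ℕ) (z : Fin s → ι → E) :
    interpMinor α J z = (Matrix.of fun a b => interpCoeff α (J b) (z a)).det := rfl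

/-- A minor of vectors indexed by `ι`. -/
def rowMinor (E : Type*) [Field E] {ι : Type*} {s : ℕ} (I : Fin s → ι) :
    (ι → E) [⋀^Fin s]→ₗ[E] E :=
  Matrix.detRowAlternating.compLinearMap (LinearMap.funLeft E E I)

theorem rowMinor_apply {s : ℕ} (I : Fin s → ι) (z : Fin s → ι → E) :
    rowMinor E I z = (Matrix.of fun a b => z a (I b)).det := rfl

end Coordinates

/-! ### Degree bounds from denominators in `x` and in `1/x`. -/

section TwoDenominators

variable {K E ι : Type*} [Field K] [Field E] [Algebra K[X] E] [Algebra K E]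
  [IsScalarTower K K[X] E]

theorem algebraMap_eq_aeval (f : K[X]) :
    algebraMap K[X] E f = aeval (algebraMap K[X] E X) f := by
  rw [aeval_algebraMap_apply, aeval_X_left_apply]

/-- As a rational function `G = g₂(1/x) / e₂(1/x)` has degree at most `deg e₂`, because a polynomial
in `1/x` has degree at most `0` and, if nonzero, at least minus its degree in `1/x`. Comparing with
`G = g₁ / e₁` gives the bound. -/
theorem natDegree_le_of_mul_eq {ξ : E} (hξ : Function.Injective (aeval ξ : K[X] →ₐ[K] E))
    {e₁ g₁ e₂ g₂ : K[X]} {G : E} (hG : G ≠ 0) (he₁ : e₁ ≠ 0) (he₂ : e₂ ≠ 0)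
    (h₁ : aeval ξ e₁ * G = aeval ξ g₁) (h₂ : aeval ξ⁻¹ e₂ * G = aeval ξ⁻¹ g₂) :
    g₁.natDegree ≤ e₁.natDegree + e₂.natDegree := by
  have hξ0 : ξ ≠ 0 := by
    intro h
    have : (X : K[X]) = 0 := hξ (by rw [aeval_X, map_zero, h])
    exact X_ne_zero this
  let : Invertible ξ := invertibleOfNonzero hξ0
  have hrev (f : K[X]) : aeval ξ⁻¹ f * ξ ^ f.natDegree = aeval ξ f.reverse := by
    have h := eval₂_reflect_mul_pow (algebraMap K E) ξ f.natDegree f.reverse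
      (reverse_natDegree_le f)
    rw [reverse, reflect_reflect, invOf_eq_inv] at h
    exact h
  have hg₁ : g₁ ≠ 0 := by
    rintro rfl
    rw [map_zero, mul_eq_zero] at h₁
    exact h₁.elim (fun h => he₁ (hξ (by rw [h, map_zero]))) hG
  have hg₂ : g₂ ≠ 0 := by
    rintro rfl
    rw [map_zero, mul_eq_zero] at h₂
    exact h₂.elim (fun h => he₂ (aeval_inv_injective hξ (by rw [h, map_zero]))) hG
  have key : e₁ * g₂.reverse * X ^ e₂.natDegree = g₁ * e₂.reverse * X ^ g₂.natDegree := by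
    apply hξ
    simp only [map_mul, map_pow, aeval_X, ← hrev, ← h₁]
    rw [← h₂]
    ring
  have hr₁ : g₂.reverse ≠ 0 := by rwa [Ne, reverse_eq_zero]
  have hr₂ : e₂.reverse ≠ 0 := by rwa [Ne, reverse_eq_zero]
  have hdeg := congrArg natDegree key
  rw [natDegree_mul_X_pow _ (mul_ne_zero he₁ hr₁), natDegree_mul_X_pow _ (mul_ne_zero hg₁ hr₂),
    natDegree_mul he₁ hr₁, natDegree_mul hg₁ hr₂] at hdeg
  have := reverse_natDegree_le g₂
  omega

variable [Fintype ι] [DecidableEq ι] {p : K[X][X]} {d : ℕ} {α : ι → E}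

/-- On the base lattice the coordinates are the coefficients of the polynomials themselves, so the
minors lie in the image of `R`. It is used with `R = K[X]` mapped by `x` and by `1/x`. -/
theorem interpMinor_mem_range {R : Type*} [CommRing R] (φ : R →+* E)
    (hα : Function.Injective α) {s : ℕ} (J : Fin s → ℕ)
    (q : Fin s → R[X]) (hq : ∀ a, q a ∈ degreeLT R (Fintype.card ι)) :
    interpMinor α J (fun a i => eval₂ φ (α i) (q a)) ∈ φ.range.toAddSubgroup := by
  refine ⟨(Matrix.of fun a b => (q a).coeff (J b)).det, ?_⟩
  rw [RingHom.map_det, interpMinor_apply]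
  congr 1
  ext a b
  have hdeg : ((q a).map φ).degree < Fintype.card ι :=
    degree_map_le.trans_lt (mem_degreeLT.mp (hq a))
  have h := interpCoeff_eval hα hdeg (J b)
  simp only [eval_map, coeff_map] at h
  exact h.symm

/-- The minors of the coordinates of the derivatives of the vector of the roots are quotients of
polynomials whose numerator has bounded degree. -/
theorem SimpleRoots.exists_interpMinor_eq (h : SimpleRoots p d α) (hn : 0 < p.natDegree)
    (D : Derivation K E E) (hD : D (algebraMap K[X] E X) = 1) (k : ℕ) :
    ∃ e : K[X], e ≠ 0 ∧ ∀ (s : ℕ) (J j : Fin s → ℕ), (∀ a, j a < k) → ∃ g : K[X],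
      g.natDegree ≤ 2 * (k * ((2 * p.natDegree - 1) * d)) ∧
      algebraMap K[X] E e * interpMinor α J (fun a i => D^[j a] (α i)) = algebraMap K[X] E g := by
  set ξ := algebraMap K[X] E X
  have hξ : Function.Injective (aeval ξ : K[X] →ₐ[K] E) := fun f g hfg =>
    h.algebraMap_injective (by rw [algebraMap_eq_aeval, algebraMap_eq_aeval g]; exact hfg)
  have hξ0 : ξ ≠ 0 := by
    intro h
    have : (X : K[X]) = 0 := hξ (by rw [aeval_X, map_zero, h])
    exact X_ne_zero this
  obtain ⟨e₁, he₁, hd₁, h₁⟩ := h.exists_mul_alternating_mem hn D derivative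
    (fun f => by rw [algebraMap_eq_aeval, algebraMap_eq_aeval (derivative f), D.map_aeval, hD,
      smul_eq_mul, mul_one]) k
  have hp' : reflectCoeffs d p ≠ 0 := by
    intro h0
    refine h.ne_zero (leadingCoeff_eq_zero.mp ?_)
    have := reflectCoeffs_coeff d p p.natDegree
    rw [h0, coeff_zero, eq_comm, reflect_eq_zero_iff] at this
    exact this
  -- The roots of `p` are also those of `x^d p(1/x, y)`, so the lattice argument runs over `K[1/x]`,
  -- where the derivation is `f ↦ -X² f'`.
  obtain ⟨e₂, he₂, hd₂, h₂⟩ := exists_mul_alternating_mem_of_algHom (aeval ξ⁻¹ : K[X] →ₐ[K] E)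
    (aeval_inv_injective hξ) (p := reflectCoeffs d p) (d := d) (α := α)
    (fun i => by rw [reflectCoeffs_coeff]; exact natDegree_reflect_le' (h.natDegree_coeff_le i))
    h.injective (by rw [natDegree_reflectCoeffs, h.card_eq]) hp'
    (fun i => by
      have h1 := eval₂_reflectCoeffs hξ0 h.natDegree_coeff_le (α i)
      have h2 : eval₂ (aeval ξ : K[X] →ₐ[K] E).toRingHom (α i) p = 0 := by
        rw [← h.root i, aeval_def]
        congr 1
        exact RingHom.ext fun f => (algebraMap_eq_aeval f).symm
      rw [h2] at h1
      exact (mul_eq_zero.mp h1).resolve_right (pow_ne_zero _ hξ0))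
    (by rwa [natDegree_reflectCoeffs]) D (fun f => -X ^ 2 * derivative f)
    (fun f => by
      rw [D.map_aeval, Derivation.leibniz_inv, hD, map_mul, map_neg, map_pow, aeval_X]
      simp only [smul_eq_mul]
      ring) k
  rw [natDegree_reflectCoeffs] at hd₂ h₂
  refine ⟨e₁, he₁, fun s J j hj => ?_⟩
  obtain ⟨g₁, hg₁⟩ := h₁ s (interpMinor α J) (algebraMap K[X] E).range.toAddSubgroup
    (fun f z hz => (algebraMap K[X] E).range.mul_mem ⟨f, rfl⟩ hz)
    (fun q hq => interpMinor_mem_range (algebraMap K[X] E) h.injective J q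
      (by rw [h.card_eq]; exact hq)) j hj
  obtain ⟨g₂, hg₂⟩ := h₂ s (interpMinor α J)
    (aeval ξ⁻¹ : K[X] →ₐ[K] E).toRingHom.range.toAddSubgroup
    (fun f z hz => (aeval ξ⁻¹ : K[X] →ₐ[K] E).toRingHom.range.mul_mem ⟨f, rfl⟩ hz)
    (fun q hq => interpMinor_mem_range (aeval ξ⁻¹ : K[X] →ₐ[K] E).toRingHom h.injective J q
      (by rw [h.card_eq]; exact hq)) j hj
  refine ⟨g₁, ?_, hg₁.symm⟩
  by_cases hG : interpMinor α J (fun a i => D^[j a] (α i)) = 0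
  · rw [hG, mul_zero] at hg₁
    have : g₁ = 0 := h.algebraMap_injective (by rw [hg₁, map_zero])
    rw [this, natDegree_zero]
    exact Nat.zero_le _
  · have := natDegree_le_of_mul_eq hξ hG he₁ he₂
      (by rw [algebraMap_eq_aeval e₁, algebraMap_eq_aeval g₁] at hg₁; exact hg₁.symm) hg₂.symm
    omega

end TwoDenominators

/-! ### Minimality of the order gives nonzero minors and Wronskians. -/

section Independence

variable {K E ι : Type*} [Field K] [Field E] [Algebra K[X] E] [Algebra K E]
  [IsScalarTower K K[X] E] [Fintype ι] [DecidableEq ι] {p : K[X][X]} {d : ℕ} {α : ι → E}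

/-- If no operator of order less than `r` cancels all the roots, then some minor of size `r` of the
coordinates of the derivatives of the roots does not vanish. -/
theorem SimpleRoots.exists_interpMinor_ne_zero (h : SimpleRoots p d α) (hn : 0 < p.natDegree)
    (D : Derivation K E E) (hD : D (algebraMap K[X] E X) = 1) {r : ℕ}
    (hr : ∀ M : K[X][X], M ≠ 0 → (∀ i, applyOp D M (α i) = 0) → r ≤ M.natDegree) :
    ∃ J : Fin r → ℕ, interpMinor α J (fun a i => D^[(a : ℕ)] (α i)) ≠ 0 := by
  obtain ⟨e, he0, he⟩ := h.exists_interpMinor_eq hn D hD r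
  -- Minors of size one: the individual coordinates are rational with common denominator `e`. A
  -- `K[x]`-relation between the resulting rows would be an operator of order below `r` cancelling
  -- the roots.
  have hu : ∀ (a : Fin r) (j : Fin (Fintype.card ι)), ∃ g : K[X],
      algebraMap K[X] E e * interpCoeff α j (fun i => D^[(a : ℕ)] (α i)) =
        algebraMap K[X] E g := by
    intro a j
    obtain ⟨g, -, hg⟩ := he 1 (fun _ => j) (fun _ => a) (fun _ => a.2)
    rw [interpMinor_apply, Matrix.det_fin_one] at hg
    exact ⟨g, hg⟩
  choose u hu using hu
  have he0' : algebraMap K[X] E e ≠ 0 := fun h0 =>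
    he0 (h.algebraMap_injective (by rw [h0, map_zero]))
  have hli : LinearIndependent K[X] u := by
    rw [Fintype.linearIndependent_iff]
    intro c hc
    by_contra! hne
    obtain ⟨a₀, ha₀⟩ := hne
    have hr0 : 0 < r := a₀.pos
    let M : K[X][X] := ofCoeffs K[X] r c
    have hM : M ≠ 0 := by
      intro h0
      have := ofCoeffs_coeff c a₀
      rw [show ofCoeffs K[X] r c = 0 from h0, coeff_zero] at this
      exact ha₀ this.symm
    have hMd : M.natDegree < r :=
      (natDegree_lt_iff_degree_lt hM).mpr (mem_degreeLT.mp (ofCoeffs_mem c))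
    refine absurd (hr M hM fun i => ?_) (not_le.mpr hMd)
    have hsum : ∀ i, applyOp D M (α i) =
        (∑ a, algebraMap K[X] E (c a) • (fun i => D^[(a : ℕ)] (α i)) : ι → E) i := by
      intro i
      rw [applyOp, sum_over_range' _ (fun n => by rw [map_zero, zero_mul]) r hMd,
        Finset.sum_range, Finset.sum_apply]
      refine Finset.sum_congr rfl fun a _ => ?_
      rw [ofCoeffs_coeff]
      rfl
    rw [hsum]
    refine congrFun (eq_zero_of_interpCoeff_eq_zero h.injective fun j hj => ?_) i
    have h1 := congrArg (algebraMap K[X] E) (congrFun hc ⟨j, hj⟩)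
    rw [Finset.sum_apply, map_sum] at h1
    refine (mul_eq_zero.mp ?_).resolve_left he0'
    rw [map_sum, Finset.mul_sum]
    refine Eq.trans (Finset.sum_congr rfl fun a _ => ?_) (h1.trans (map_zero _))
    rw [map_smul, smul_eq_mul, Pi.smul_apply, smul_eq_mul, map_mul, ← hu]
    ring
  obtain ⟨J, hJ⟩ := exists_det_ne_zero_of_linearIndependent_of_isDomain hli
  refine ⟨fun b => J b, fun h0 => hJ (h.algebraMap_injective ?_)⟩
  rw [RingHom.map_det, map_zero]
  have h1 : (algebraMap K[X] E).mapMatrix (Matrix.of fun a b => u a (J b)) =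
      algebraMap K[X] E e • Matrix.of fun (a b : Fin r) =>
        interpCoeff α (J b) (fun i => D^[(a : ℕ)] (α i)) := by
    ext a b
    exact (hu a (J b)).symm
  rw [h1, Matrix.det_smul, ← interpMinor_apply, h0, mul_zero]

theorem exists_rowMinor_ne_zero {r : ℕ} {z : Fin r → ι → E} {J : Fin r → ℕ}
    (hJ : interpMinor α J z ≠ 0) : ∃ I : Fin r → ι, rowMinor E I z ≠ 0 := by
  have hli : LinearIndependent E z := by
    by_contra hli
    exact hJ ((interpMinor α J).map_linearDependent z hli)
  exact exists_det_ne_zero_of_linearIndependent hli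

end Independence

/-! ### Solutions as constant combinations. -/

section Constants

variable {K E ι : Type*} [Field K] [Field E] [Algebra K[X] E] [Algebra K E]

/-- A solution of an operator of order `r` is a combination with constant coefficients of `r`
solutions with a nonvanishing Wronskian. -/
theorem exists_constant_combination (D : Derivation K E E)
    (hinj : Function.Injective (algebraMap K[X] E)) {L : K[X][X]} (hL : L ≠ 0)
    {r : ℕ} (hr : L.natDegree = r) {β : Fin r → E} (hβ : ∀ b, applyOp D L (β b) = 0)
    (hW : (Matrix.of fun a b : Fin r => D^[(a : ℕ)] (β b)).det ≠ 0) {y : E}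
    (hy : applyOp D L y = 0) :
    ∃ c : Fin r → E, (∀ b, D (c b) = 0) ∧
      ∀ a < r, D^[a] y = ∑ b, c b * D^[a] (β b) := by
  let A : Matrix (Fin r) (Fin r) E := Matrix.of fun a b => D^[(a : ℕ)] (β b)
  have hA : IsUnit A.det := isUnit_iff_ne_zero.mpr hW
  let c : Fin r → E := A⁻¹.mulVec fun a : Fin r => D^[(a : ℕ)] y
  have hc : A.mulVec c = fun a : Fin r => D^[(a : ℕ)] y := by
    rw [Matrix.mulVec_mulVec, Matrix.mul_nonsing_inv _ hA, Matrix.one_mulVec]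
  have h1 : ∀ a < r, D^[a] y = ∑ b, c b * D^[a] (β b) := by
    intro a ha
    have h0 : ∑ b, A ⟨a, ha⟩ b * c b = D^[a] y := congrFun hc ⟨a, ha⟩
    rw [← h0]
    exact Finset.sum_congr rfl fun b _ => mul_comm _ _
  have hlead : algebraMap K[X] E (L.coeff r) ≠ 0 := fun h0 =>
    leadingCoeff_ne_zero.mpr hL (hinj (by rw [map_zero, ← h0, ← hr]; rfl))
  have happ : ∀ z : E, applyOp D L z =
      ∑ a ∈ Finset.range (r + 1), algebraMap K[X] E (L.coeff a) * D^[a] z := by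
    intro z
    rw [applyOp, sum_over_range _ (fun n => by rw [map_zero, zero_mul]), hr]
  have h2 : D^[r] y = ∑ b, c b * D^[r] (β b) := by
    have hz : ∀ z, applyOp D L z = 0 → algebraMap K[X] E (L.coeff r) * D^[r] z =
        -∑ a ∈ Finset.range r, algebraMap K[X] E (L.coeff a) * D^[a] z := by
      intro z hz
      rw [happ, Finset.sum_range_succ] at hz
      linear_combination hz
    apply mul_left_cancel₀ hlead
    rw [hz y hy, Finset.mul_sum]
    have h3 : ∀ b ∈ Finset.univ, algebraMap K[X] E (L.coeff r) * (c b * D^[r] (β b)) =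
        c b * -∑ a ∈ Finset.range r, algebraMap K[X] E (L.coeff a) * D^[a] (β b) := by
      intro b _
      rw [← hz _ (hβ b)]; ring
    rw [Finset.sum_congr rfl h3]
    simp only [mul_neg, Finset.sum_neg_distrib, Finset.mul_sum]
    rw [Finset.sum_comm]
    congr 1
    refine Finset.sum_congr rfl fun a ha => ?_
    rw [h1 a (Finset.mem_range.mp ha), Finset.mul_sum]
    exact Finset.sum_congr rfl fun b _ => by ring
  have h3 : ∀ a < r, D^[a + 1] y = ∑ b, c b * D^[a + 1] (β b) := by
    intro a ha
    rcases (Nat.succ_le_of_lt ha).eq_or_lt with h | h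
    · rw [show a + 1 = r from h]; exact h2
    · exact h1 _ h
  -- Differentiating the relation of order `a` and subtracting that of order `a + 1` leaves only the
  -- derivatives of the `c b`; the relation of order `r` needed for the last row is `h2`, which
  -- comes from `L`.
  have h4 : A.mulVec (fun b => D (c b)) = 0 := by
    ext1 a
    have h5 := congrArg D (h1 a a.2)
    rw [← Function.iterate_succ_apply' D, h3 a a.2, map_sum] at h5
    simp only [Derivation.leibniz, Finset.sum_add_distrib, smul_eq_mul,
      ← Function.iterate_succ_apply' D] at h5
    have h6 : ∑ b, D^[(a : ℕ)] (β b) * D (c b) = 0 := by linear_combination -h5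
    exact h6
  refine ⟨c, fun b => ?_, h1⟩
  have h5 := congrArg A⁻¹.mulVec h4
  rw [Matrix.mulVec_mulVec, Matrix.nonsing_inv_mul _ hA, Matrix.one_mulVec, Matrix.mulVec_zero]
    at h5
  exact congrFun h5 b

end Constants

/-! ### Valuation estimates for roots, minors and coordinates. -/

section Growth

variable {K E ι Γ : Type*} [Field K] [Field E] [Algebra K[X] E] [Algebra K E]
  [LinearOrderedCommGroupWithZero Γ]

/-- A valuation on a differential extension of `K[x]`, with `T` the inverse of the value of `x`,
which is trivial on the constants. -/
structure IsGrowth (D : Derivation K E E) (v : Valuation E Γ) (T : Γ) : Prop where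
  one_lt : 1 < T
  le_one : ∀ f : K[X], v (algebraMap K[X] E f) ≤ 1
  one_le_mul : ∀ f : K[X], f ≠ 0 → 1 ≤ v (algebraMap K[X] E f) * T ^ f.natDegree
  const_le_one : ∀ c : E, D c = 0 → v c ≤ 1

variable {D : Derivation K E E} {v : Valuation E Γ} {T : Γ}

theorem IsGrowth.one_le_pow (hv : IsGrowth D v T) (k : ℕ) : 1 ≤ T ^ k :=
  one_le_pow₀ hv.one_lt.le

theorem IsGrowth.const_eq_one (hv : IsGrowth D v T) {c : E} (hc : D c = 0) (h0 : c ≠ 0) :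
    v c = 1 := by
  refine le_antisymm (hv.const_le_one c hc) ?_
  have h1 := hv.const_le_one c⁻¹ (by rw [D.leibniz_inv, hc, smul_zero])
  rw [map_inv₀] at h1
  exact (inv_le_one₀ (zero_lt_iff.mpr (v.ne_zero_iff.mpr h0))).mp h1

theorem IsGrowth.one_le_mul_pow (hv : IsGrowth D v T) {f : K[X]} (hf : f ≠ 0) {k : ℕ}
    (hk : f.natDegree ≤ k) : 1 ≤ v (algebraMap K[X] E f) * T ^ k :=
  (hv.one_le_mul f hf).trans (mul_le_mul_right (pow_le_pow_right₀ hv.one_lt.le hk) _)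

theorem Valuation.det_le {s : ℕ} (v : Valuation E Γ) (A : Matrix (Fin s) (Fin s) E) {B : Γ}
    (hA : ∀ a b, v (A a b) ≤ B) : v A.det ≤ B ^ s := by
  rw [Matrix.det_apply]
  refine v.map_sum_le fun σ _ => ?_
  have h1 : v (Equiv.Perm.sign σ • ∏ i, A (σ i) i) = v (∏ i, A (σ i) i) := by
    rcases Int.units_eq_one_or (Equiv.Perm.sign σ) with h | h <;> rw [h]
    · rw [one_smul]
    · rw [Units.neg_smul, one_smul, Valuation.map_neg]
  rw [h1, map_prod]
  refine (Finset.prod_le_prod' fun i _ => hA (σ i) i).trans_eq ?_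
  rw [Finset.prod_const, Finset.card_univ, Fintype.card_fin]

variable [Fintype ι] {p : K[X][X]} {d : ℕ} {α : ι → E}

/-- If `v α > 1`, isolating the leading term of `p(α) = 0` shows that the leading coefficient times
`α` has value at most `1`; that coefficient has value at least `T^(-d)`. -/
theorem SimpleRoots.valuation_root_le (h : SimpleRoots p d α) (hv : IsGrowth D v T) (i : ι) :
    v (α i) ≤ T ^ d := by
  by_cases h1 : v (α i) ≤ 1
  · exact h1.trans (hv.one_le_pow d)
  push Not at h1
  have h0 : 0 < v (α i) := zero_lt_one.trans h1
  have hlead := h.root i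
  rw [aeval_eq_sum_range, Finset.sum_range_succ] at hlead
  have hn : p.natDegree ≠ 0 := by
    rw [← h.card_eq]; exact (Fintype.card_pos_iff.mpr ⟨i⟩).ne'
  have h2 : v (algebraMap K[X] E p.leadingCoeff) * v (α i) ^ p.natDegree ≤
      v (α i) ^ (p.natDegree - 1) := by
    rw [← map_pow, ← map_mul, ← Algebra.smul_def, leadingCoeff, eq_neg_of_add_eq_zero_right hlead,
      Valuation.map_neg]
    refine v.map_sum_le fun j hj => ?_
    rw [Algebra.smul_def, map_mul, map_pow]
    refine (mul_le_of_le_one_left' (hv.le_one _)).trans ?_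
    exact pow_le_pow_right₀ h1.le (by have := Finset.mem_range.mp hj; omega)
  have h3 : v (algebraMap K[X] E p.leadingCoeff) * v (α i) ≤ 1 := by
    obtain ⟨m, hm⟩ := Nat.exists_eq_succ_of_ne_zero hn
    rw [hm, Nat.succ_sub_one, pow_succ', ← mul_assoc] at h2
    exact le_of_mul_le_mul_right (by rwa [one_mul]) (pow_pos h0 m)
  have h4 := hv.one_le_mul_pow (leadingCoeff_ne_zero.mpr h.ne_zero)
    (h.natDegree_coeff_le p.natDegree)
  calc v (α i) ≤ v (α i) * (v (algebraMap K[X] E p.leadingCoeff) * T ^ d) := le_mul_of_one_le_right' h4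
    _ = (v (algebraMap K[X] E p.leadingCoeff) * v (α i)) * T ^ d := by
      rw [← mul_assoc, mul_comm (v (α i))]
    _ ≤ T ^ d := mul_le_of_le_one_left' h3

theorem SimpleRoots.valuation_aeval_le (h : SimpleRoots p d α) (hv : IsGrowth D v T)
    {q : K[X][X]} (hq : q ∈ degreeLT K[X] p.natDegree) (i : ι) :
    v (aeval (α i) q) ≤ T ^ (p.natDegree * d) := by
  rw [aeval_eq_sum_range]
  refine v.map_sum_le fun j _ => ?_
  by_cases hj : p.natDegree ≤ j
  · rw [coeff_eq_zero_of_degree_lt ((mem_degreeLT.mp hq).trans_le (Nat.cast_le.mpr hj)), zero_smul,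
      map_zero]
    exact zero_le
  · rw [Algebra.smul_def, map_mul, map_pow]
    refine (mul_le_of_le_one_left' (hv.le_one _)).trans ?_
    refine (pow_le_pow_left₀ zero_le (h.valuation_root_le hv i) j).trans ?_
    rw [← pow_mul]
    exact pow_le_pow_right₀ hv.one_lt.le (by rw [mul_comm]; gcongr; omega)

/-- The Horner recursion relating the coefficients of `p` and `p / (y - a)` stays integral if run
downwards when `v a ≤ 1`, and upwards, dividing by `a`, when `v a > 1`. -/
theorem valuation_coeff_rootQuotient_le (hv : IsGrowth D v T) {a : E} (ha : aeval a p = 0)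
    (j : ℕ) : v ((rootQuotient p a).coeff j) ≤ 1 := by
  have hmul := X_sub_C_mul_rootQuotient ha
  have hsucc (j : ℕ) : algebraMap K[X] E (p.coeff (j + 1)) =
      (rootQuotient p a).coeff j - a * (rootQuotient p a).coeff (j + 1) := by
    rw [← coeff_map, ← hmul, sub_mul, coeff_sub, coeff_X_mul, coeff_C_mul]
  by_cases h1 : v a ≤ 1
  · by_contra hj
    have hinf : ∀ k, ¬ v ((rootQuotient p a).coeff (j + k)) ≤ 1 := by
      intro k
      induction k with
      | zero => exact hj
      | succ k ih =>
        intro h2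
        refine ih ?_
        have h3 : (rootQuotient p a).coeff (j + k) = algebraMap K[X] E (p.coeff (j + k + 1)) +
          a * (rootQuotient p a).coeff (j + k + 1) := by rw [hsucc]; ring
        rw [h3]
        refine v.map_add_le (hv.le_one _) ?_
        rw [map_mul]
        exact mul_le_one' h1 h2
    refine hinf ((rootQuotient p a).natDegree + 1) ?_
    rw [coeff_eq_zero_of_natDegree_lt (by omega), map_zero]
    exact zero_le_one
  · push Not at h1
    have ha0 : a ≠ 0 := by
      rintro rfl
      rw [map_zero] at h1
      exact absurd h1 (not_lt.mpr zero_le)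
    have hinv : v a⁻¹ ≤ 1 := by
      rw [map_inv₀]; exact inv_le_one_of_one_le₀ h1.le
    induction j with
    | zero =>
      have h2 : (rootQuotient p a).coeff 0 = -(a⁻¹ * algebraMap K[X] E (p.coeff 0)) := by
        rw [← coeff_map, ← hmul, sub_mul, coeff_sub, coeff_X_mul_zero, coeff_C_mul]
        field_simp
        ring
      rw [h2, Valuation.map_neg, map_mul]
      exact mul_le_one' hinv (hv.le_one _)
    | succ j ih =>
      have h2 : (rootQuotient p a).coeff (j + 1) =
          a⁻¹ * ((rootQuotient p a).coeff j - algebraMap K[X] E (p.coeff (j + 1))) := by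
        rw [hsucc]
        field_simp
        ring
      rw [h2, map_mul]
      exact mul_le_one' hinv (v.map_sub_le ih (hv.le_one _))

variable [IsScalarTower K K[X] E]

theorem SimpleRoots.valuation_inv_derivative_le (h : SimpleRoots p d α) (hv : IsGrowth D v T)
    (i : ι) : v (aeval (α i) (derivative p))⁻¹ ≤ T ^ (3 * (p.natDegree * d)) := by
  have hn : 0 < p.natDegree := by
    rw [← h.card_eq]; exact Fintype.card_pos_iff.mpr ⟨i⟩
  obtain ⟨e, he0, hed, q, hq, heq⟩ := h.exists_mul_inv_derivative hn
  have h1 := hv.one_le_mul_pow he0 hed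
  have h0 := h.aeval_derivative_ne_zero i
  calc v (aeval (α i) (derivative p))⁻¹
      ≤ v (aeval (α i) (derivative p))⁻¹ *
        (v (algebraMap K[X] E e) * T ^ ((2 * p.natDegree - 1) * d)) := le_mul_of_one_le_right' h1
    _ = v (aeval (α i) q) * T ^ ((2 * p.natDegree - 1) * d) := by
      rw [← mul_assoc, ← map_mul, heq i, mul_comm (aeval (α i) q), inv_mul_cancel_left₀ h0]
    _ ≤ T ^ (p.natDegree * d) * T ^ ((2 * p.natDegree - 1) * d) :=
      mul_le_mul_left (h.valuation_aeval_le hv hq i) _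
    _ ≤ T ^ (3 * (p.natDegree * d)) := by
      rw [← pow_add]
      refine pow_le_pow_right₀ hv.one_lt.le ?_
      have : (2 * p.natDegree - 1) * d ≤ 2 * p.natDegree * d := by gcongr; omega
      linarith

variable [DecidableEq ι]

/-- By Lagrange's formula the interpolating polynomial is `∑ zᵢ p'(αᵢ)⁻¹ p / (y - αᵢ)`. The
quotients have integral coefficients, so only the inverses of `p'(αᵢ)` contribute. -/
theorem SimpleRoots.valuation_interpCoeff_le (h : SimpleRoots p d α) (hv : IsGrowth D v T)
    {z : ι → E} (hz : ∀ i, v (z i) ≤ 1) (j : ℕ) :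
    v (interpCoeff α j z) ≤ T ^ (3 * (p.natDegree * d)) := by
  let q : E[X] := ∑ i, C (z i * (aeval (α i) (derivative p))⁻¹) * rootQuotient p (α i)
  have hq : q.degree < Fintype.card ι := by
    rw [h.card_eq, ← mem_degreeLT]
    refine Submodule.sum_mem _ fun i _ => ?_
    rw [← smul_eq_C_mul]
    exact Submodule.smul_mem _ _ (mem_degreeLT.mpr (h.degree_rootQuotient_lt i))
  have hqz : z = fun i => q.eval (α i) := by
    ext1 i
    rw [eval_finsetSum, Finset.sum_eq_single i]
    · rw [eval_mul, eval_C, h.eval_rootQuotient_self,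
        inv_mul_cancel_right₀ (h.aeval_derivative_ne_zero i)]
    · intro b _ hb
      rw [eval_mul, h.eval_rootQuotient_ne hb.symm, mul_zero]
    · exact fun h => absurd (Finset.mem_univ i) h
  rw [hqz, interpCoeff_eval h.injective hq, finsetSum_coeff]
  refine v.map_sum_le fun i _ => ?_
  rw [coeff_C_mul, map_mul, map_mul]
  refine (mul_le_of_le_one_right' (valuation_coeff_rootQuotient_le hv (h.root i) j)).trans ?_
  exact (mul_le_of_le_one_left' (hz i)).trans (h.valuation_inv_derivative_le hv i)

theorem SimpleRoots.valuation_rowMinor_le (h : SimpleRoots p d α) (hv : IsGrowth D v T)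
    (hD : D (algebraMap K[X] E X) = 1) (hn : 0 < p.natDegree) (k : ℕ)
    {s : ℕ} (I : Fin s → ι) (j : Fin s → ℕ) (hj : ∀ a, j a < k) :
    v (rowMinor E I (fun a i => D^[j a] (α i))) ≤
      T ^ (p.natDegree * d * s + k * ((2 * p.natDegree - 1) * d)) := by
  obtain ⟨e, he0, hed, he⟩ := h.exists_mul_alternating_mem hn D derivative
    (fun f => by rw [algebraMap_eq_aeval, algebraMap_eq_aeval (derivative f), D.map_aeval, hD,
      smul_eq_mul, mul_one]) k
  -- A ball of the valuation can serve as target since polynomials in `x` have value at most `1`;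
  -- the lattice argument then yields an estimate directly.
  let N : AddSubgroup E :=
    { carrier := {z | v z ≤ (T ^ (p.natDegree * d)) ^ s}
      zero_mem' := by simp
      add_mem' := fun ha hb => v.map_add_le ha hb
      neg_mem' := fun {a} ha => by
        change v (-a) ≤ _
        rwa [Valuation.map_neg] }
  have h1 : v (algebraMap K[X] E e * rowMinor E I (fun a i => D^[j a] (α i))) ≤
      (T ^ (p.natDegree * d)) ^ s := by
    refine he s (rowMinor E I) N (fun f z hz => ?_) (fun q hq => ?_) j hj
    · change v _ ≤ _
      rw [map_mul]
      exact (mul_le_of_le_one_left' (hv.le_one f)).trans hz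
    · change v _ ≤ _
      rw [rowMinor_apply]
      exact Valuation.det_le v _ fun a b => h.valuation_aeval_le hv (hq a) (I b)
  have h2 := hv.one_le_mul_pow he0 hed
  calc _ ≤ v (rowMinor E I (fun a i => D^[j a] (α i))) *
        (v (algebraMap K[X] E e) * T ^ (k * ((2 * p.natDegree - 1) * d))) :=
        le_mul_of_one_le_right' h2
    _ = v (algebraMap K[X] E e * rowMinor E I (fun a i => D^[j a] (α i))) *
        T ^ (k * ((2 * p.natDegree - 1) * d)) := by
      rw [map_mul, ← mul_assoc, mul_comm (v (rowMinor E I _))]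
    _ ≤ _ := by
      rw [pow_add, pow_mul T _ s]
      exact mul_le_mul_left h1 _

end Growth

/-! ### Wronskians and the bound on exponents. -/

section Bound

variable {K E ι Γ : Type*} [Field K] [Field E] [Algebra K[X] E] [Algebra K E]
  [IsScalarTower K K[X] E] [LinearOrderedCommGroupWithZero Γ] [Fintype ι]
  {D : Derivation K E E} {v : Valuation E Γ} {T : Γ} {p : K[X][X]} {d : ℕ} {α : ι → E}

theorem SimpleRoots.derivation_root_eq_zero (h : SimpleRoots p 0 α) (i : ι) : D (α i) = 0 := by
  have hp : p = (p.map (evalRingHom 0)).map C := by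
    ext1 j
    rw [coeff_map, coeff_map, coe_evalRingHom, ← coeff_zero_eq_eval_zero]
    exact eq_C_of_natDegree_eq_zero (Nat.le_zero.mp (h.natDegree_coeff_le j))
  have haev (q : K[X]) : aeval (α i) (q.map C) = aeval (α i) q := by
    rw [← algebraMap_eq, aeval_map_algebraMap]
  have h1 := D.map_aeval (p.map (evalRingHom 0)) (α i)
  rw [← haev, ← haev, ← derivative_map, ← hp, h.root, map_zero, smul_eq_mul] at h1
  exact (mul_eq_zero.mp h1.symm).resolve_left (h.aeval_derivative_ne_zero i)

variable [DecidableEq ι]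

theorem SimpleRoots.one_le_valuation_interpMinor (h : SimpleRoots p d α) (hv : IsGrowth D v T)
    (hD : D (algebraMap K[X] E X) = 1) (hn : 0 < p.natDegree) (k : ℕ)
    {s : ℕ} (J j : Fin s → ℕ) (hj : ∀ a, j a < k)
    (hJ : interpMinor α J (fun a i => D^[j a] (α i)) ≠ 0) :
    1 ≤ v (interpMinor α J (fun a i => D^[j a] (α i))) *
      T ^ (2 * (k * ((2 * p.natDegree - 1) * d))) := by
  obtain ⟨e, he0, he⟩ := h.exists_interpMinor_eq hn D hD k
  obtain ⟨g, hgd, hg⟩ := he s J j hj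
  have hg0 : g ≠ 0 := by
    rintro rfl
    rw [map_zero, mul_eq_zero] at hg
    exact hg.elim (fun h0 => he0 (h.algebraMap_injective (by rw [h0, map_zero]))) hJ
  refine (hv.one_le_mul_pow hg0 hgd).trans (mul_le_mul_left ?_ _)
  rw [← hg, map_mul]
  exact mul_le_of_le_one_left' (hv.le_one e)

/-- Lower bound for the valuation of a Wronskian of roots. -/
theorem SimpleRoots.one_le_valuation_wronskian (h : SimpleRoots p d α) (hv : IsGrowth D v T)
    (hD : D (algebraMap K[X] E X) = 1) (hn : 0 < p.natDegree) {L : K[X][X]} (hL : L ≠ 0)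
    (hα : ∀ i, applyOp D L (α i) = 0) {r : ℕ} (hr : L.natDegree = r) {I : Fin r → ι}
    (hI : rowMinor E I (fun a i => D^[(a : ℕ)] (α i)) ≠ 0) {J : Fin r → ℕ}
    (hJ : interpMinor α J (fun a i => D^[(a : ℕ)] (α i)) ≠ 0) :
    1 ≤ v (rowMinor E I (fun a i => D^[(a : ℕ)] (α i))) *
      T ^ (3 * (p.natDegree * d) * r + 2 * (r * ((2 * p.natDegree - 1) * d))) := by
  have hκ (i : ι) := exists_constant_combination D h.algebraMap_injective hL hr
    (β := fun b => α (I b)) (fun b => hα _) hI (hα i)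
  choose κ hκ0 hκ using hκ
  -- Every root is a constant combination of the `α (I b)` with coefficients `κ i b`, so the
  -- coordinate matrix of the derivatives factors through the Wronskian matrix.
  have hG : interpMinor α J (fun a i => D^[(a : ℕ)] (α i)) =
      rowMinor E I (fun a i => D^[(a : ℕ)] (α i)) *
        (Matrix.of fun b b' => interpCoeff α (J b') (fun i => κ i b)).det := by
    rw [rowMinor_apply, interpMinor_apply, ← Matrix.det_mul]
    congr 1
    ext a b'
    have h1 : (fun i => D^[(a : ℕ)] (α i)) =
        ∑ b, D^[(a : ℕ)] (α (I b)) • fun i => κ i b := by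
      ext1 i
      rw [hκ i a a.2, Finset.sum_apply]
      exact Finset.sum_congr rfl fun b _ => mul_comm _ _
    rw [Matrix.of_apply, h1, map_sum, Matrix.mul_apply]
    exact Finset.sum_congr rfl fun b _ => map_smul _ _ _
  have h1 := h.one_le_valuation_interpMinor hv hD hn r J (fun a => a) (fun a => a.2) hJ
  rw [hG, map_mul] at h1
  refine h1.trans ?_
  rw [mul_assoc, pow_add, pow_mul T (3 * _)]
  refine mul_le_mul_right (mul_le_mul_left (Valuation.det_le v _ fun b b' => ?_) _) _
  exact h.valuation_interpCoeff_le hv (fun i => hv.const_le_one _ (hκ0 i b)) _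

/-- The valuations of the solutions of an operator of least order cancelling the roots. -/
theorem SimpleRoots.exponent_bounds (h : SimpleRoots p d α) (hv : IsGrowth D v T)
    (hD : D (algebraMap K[X] E X) = 1) (hn : 0 < p.natDegree) {L : K[X][X]} (hL : L ≠ 0)
    (hα : ∀ i, applyOp D L (α i) = 0)
    (hmin : ∀ M : K[X][X], M ≠ 0 → (∀ i, applyOp D M (α i) = 0) → L.natDegree ≤ M.natDegree)
    {y : E} (hy0 : y ≠ 0) (hy : applyOp D L y = 0) {m : ℤ} (hm : v y = T ^ (-m))
    (hmk : ∀ k : ℕ, v (D^[k] y) ≤ T ^ ((k : ℤ) - m)) :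
    -(d : ℤ) ≤ m ∧ m ≤ 11 * d * p.natDegree ^ 2 := by
  set n := p.natDegree with hn'
  -- From here the order is `r + 1`, so the minors left by the Laplace expansion have size `r`.
  obtain ⟨r, hr⟩ : ∃ r, L.natDegree = r + 1 := by
    refine Nat.exists_eq_succ_of_ne_zero fun h0 => hy0 ?_
    rw [eq_C_of_natDegree_eq_zero h0, applyOp, sum_C_index (by rw [map_zero, zero_mul])] at hy
    refine (mul_eq_zero.mp hy).resolve_left fun h1 => hL ?_
    rw [eq_C_of_natDegree_eq_zero h0, h.algebraMap_injective (h1.trans (map_zero _).symm), C_0]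
  have hT0 : 0 < T := zero_lt_one.trans hv.one_lt
  obtain ⟨J, hJ⟩ := h.exists_interpMinor_ne_zero hn D hD (r := r + 1) (hr ▸ hmin)
  obtain ⟨I, hI⟩ := exists_rowMinor_ne_zero hJ
  obtain ⟨c, hc0, hc⟩ := exists_constant_combination D h.algebraMap_injective hL hr
    (β := fun b => α (I b)) (fun b => hα _) hI hy
  have hyc : y = ∑ b, c b * α (I b) := hc 0 r.succ_pos
  constructor
  · have h1 : v y ≤ T ^ (d : ℤ) := by
      rw [zpow_natCast, hyc]
      refine v.map_sum_le fun b _ => ?_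
      rw [map_mul]
      exact (mul_le_of_le_one_left' (hv.const_le_one _ (hc0 b))).trans
        (h.valuation_root_le hv _)
    rw [hm, zpow_le_zpow_iff_right₀ hv.one_lt] at h1
    omega
  have hrn : r + 1 ≤ n := by
    rw [hn', ← h.card_eq, ← Fintype.card_fin (r + 1)]
    refine Fintype.card_le_of_injective I fun b b' hbb => ?_
    by_contra hne
    refine hI ?_
    rw [rowMinor_apply]
    exact Matrix.det_zero_of_column_eq hne fun a => by rw [Matrix.of_apply, Matrix.of_apply, hbb]
  obtain ⟨b₀, hb₀⟩ : ∃ b, c b ≠ 0 := by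
    by_contra! h0
    refine hy0 ?_
    rw [hyc]
    exact Finset.sum_eq_zero fun b _ => by rw [h0, zero_mul]
  have hW := h.one_le_valuation_wronskian hv hD hn hL hα hr hI hJ
  let A : Matrix (Fin (r + 1)) (Fin (r + 1)) E := Matrix.of fun b a => D^[(a : ℕ)] (α (I b))
  let A' := A.updateRow b₀ fun a => D^[(a : ℕ)] y
  have hA : rowMinor E I (fun a i => D^[(a : ℕ)] (α i)) = A.det := by
    rw [rowMinor_apply, ← Matrix.det_transpose]
    rfl
  have hA' : A'.det = c b₀ * A.det := by
    have h1 : (fun a : Fin (r + 1) => D^[(a : ℕ)] y) = ∑ b, c b • A b := by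
      ext1 a
      rw [hc a a.2, Finset.sum_apply]
      rfl
    change (A.updateRow b₀ _).det = _
    rw [h1, Matrix.det_updateRow_sum, smul_eq_mul]
  have hvA : v A.det = v A'.det := by
    rw [hA', map_mul, hv.const_eq_one (hc0 b₀) hb₀, one_mul]
  -- Expansion along the row of `y`: derivatives of order at most `r` contribute the first factor,
  -- minors of derivatives of roots the second.
  have hA'le : v A'.det ≤ T ^ ((r : ℤ) - m) *
      T ^ (n * d * r + (r + 1) * ((2 * n - 1) * d)) := by
    rw [Matrix.det_succ_row A' b₀]
    refine v.map_sum_le fun j _ => ?_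
    rw [map_mul, map_mul, map_pow, Valuation.map_neg, map_one, one_pow, one_mul]
    refine mul_le_mul' ?_ ?_
    · rw [show A' b₀ j = D^[(j : ℕ)] y from congrFun (Matrix.updateRow_self ..) j]
      refine (hmk j).trans (zpow_le_zpow_right₀ hv.one_lt.le ?_)
      have := j.2
      omega
    · have h1 : (A'.submatrix b₀.succAbove j.succAbove).det =
          rowMinor E (fun b => I (b₀.succAbove b))
            (fun a i => D^[((j.succAbove a : Fin (r + 1)) : ℕ)] (α i)) := by
        rw [rowMinor_apply, ← Matrix.det_transpose]
        congr 1
        ext a b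
        exact congrFun (Matrix.updateRow_ne (Fin.succAbove_ne b₀ b)) (j.succAbove a)
      rw [h1]
      exact h.valuation_rowMinor_le hv hD hn (r + 1) _ _ fun a => (j.succAbove a).2
  rw [hA, hvA] at hW
  have hfin := hW.trans (mul_le_mul_left hA'le _)
  rw [← zpow_natCast, ← zpow_natCast, ← zpow_add₀ hT0.ne', ← zpow_add₀ hT0.ne',
    ← zpow_zero T, zpow_le_zpow_iff_right₀ hv.one_lt] at hfin
  -- Absorbing `r` requires `d > 0`; if `d = 0` the roots are constants, `∂` cancels them, and
  -- minimality forces `r = 0`.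
  have hr1 : (r : ℤ) ≤ d * n ^ 2 := by
    by_cases hd : d = 0
    · subst hd
      have h1 := hmin X X_ne_zero fun i => by
        rw [applyOp, sum_X_index (by rw [map_zero, zero_mul]), map_one, one_mul]
        exact h.derivation_root_eq_zero i
      rw [hr, natDegree_X] at h1
      have : r = 0 := by omega
      simp [this]
    · have h1 : n * 1 ≤ n * (d * n) := Nat.mul_le_mul_left _ (Nat.mul_pos (by omega) hn)
      have h2 : r ≤ d * n ^ 2 := by
        calc r ≤ n * 1 := by omega
          _ ≤ _ := h1
          _ = d * n ^ 2 := by ring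
      exact_mod_cast h2
  -- The four terms contribute `1 + 2 + 3 + 4 = 10` times `d n²`; `hr1` supplies the eleventh.
  have hb1 : n * d * r + (r + 1) * ((2 * n - 1) * d) +
      (3 * (n * d) * (r + 1) + 2 * ((r + 1) * ((2 * n - 1) * d))) ≤ 10 * (d * n ^ 2) := by
    calc _ ≤ n * d * n + n * (2 * n * d) + (3 * (n * d) * n + 2 * (n * (2 * n * d))) := by
          gcongr <;> omega
      _ = _ := by ring
  have hb2 : ((n * d * r + (r + 1) * ((2 * n - 1) * d) : ℕ) : ℤ) +
      ((3 * (n * d) * (r + 1) + 2 * ((r + 1) * ((2 * n - 1) * d)) : ℕ) : ℤ) ≤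
        10 * (d * n ^ 2) := by exact_mod_cast hb1
  linarith

end Bound

/-! ### Reduction to a separable polynomial. -/

section SquarefreePart

variable {K : Type*} [Field K]

theorem coeff_coeff_swap (p : K[X][X]) (i j : ℕ) :
    ((Bivariate.swap p).coeff i).coeff j = (p.coeff j).coeff i := by
  induction p using Polynomial.induction_on' with
  | add p q hp hq => simp only [map_add, coeff_add, hp, hq]
  | monomial n f =>
    induction f using Polynomial.induction_on' with
    | add f g hf hg => simp only [map_add, coeff_add, hf, hg]
    | monomial m a =>
      rw [Bivariate.swap_monomial_monomial]
      simp only [coeff_monomial]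
      split_ifs <;> simp_all [coeff_monomial]

theorem natDegree_swap_le_iff {p : K[X][X]} {d : ℕ} :
    (Bivariate.swap p).natDegree ≤ d ↔ ∀ i, (p.coeff i).natDegree ≤ d := by
  simp only [natDegree_le_iff_coeff_eq_zero]
  constructor
  · intro h i m hm
    rw [← coeff_coeff_swap, h m hm, coeff_zero]
  · intro h m hm
    ext1 i
    rw [coeff_coeff_swap, h i m hm, coeff_zero]

/-- After swapping the variables the degree in `x` becomes the outer degree, which is monotone under
divisibility. -/
theorem natDegree_coeff_le_of_dvd {p q : K[X][X]} (hpq : p ∣ q) (hq : q ≠ 0) {d : ℕ}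
    (hd : ∀ i, (q.coeff i).natDegree ≤ d) : ∀ i, (p.coeff i).natDegree ≤ d := by
  rw [← natDegree_swap_le_iff] at hd ⊢
  refine (natDegree_le_of_dvd (map_dvd Bivariate.swap hpq) ?_).trans hd
  exact (map_ne_zero_iff _ Bivariate.swap.injective).mpr hq

theorem exists_isPrimitive_map_associated (s : (RatFunc K)[X]) (hs : s ≠ 0) :
    ∃ p : K[X][X], p.IsPrimitive ∧ Associated (p.map (algebraMap K[X] (RatFunc K))) s := by
  obtain ⟨b, hb, hbs⟩ := IsLocalization.integerNormalization_spec (nonZeroDivisors K[X]) s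
  set q := IsLocalization.integerNormalization (nonZeroDivisors K[X]) s
  obtain ⟨_⟩ : Nonempty (NormalizedGCDMonoid K[X]) := inferInstance
  have hb0 : algebraMap K[X] (RatFunc K) b ≠ 0 := fun h =>
    nonZeroDivisors.ne_zero hb (IsFractionRing.injective K[X] (RatFunc K) (by rw [h, map_zero]))
  have hbs' : q.map (algebraMap K[X] (RatFunc K)) = C (algebraMap K[X] (RatFunc K) b) * s := by
    rw [hbs, ← smul_eq_C_mul, algebraMap_smul]
  have hq0 : q ≠ 0 := by
    intro h0
    rw [h0, Polynomial.map_zero, eq_comm, mul_eq_zero, C_eq_zero] at hbs'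
    exact hbs'.elim hb0 hs
  have hc0 : algebraMap K[X] (RatFunc K) q.content ≠ 0 := fun h =>
    hq0 (content_eq_zero_iff.mp (IsFractionRing.injective K[X] (RatFunc K) (by rw [h, map_zero])))
  refine ⟨q.primPart, q.isPrimitive_primPart, ?_⟩
  rw [q.eq_C_content_mul_primPart, Polynomial.map_mul, map_C] at hbs'
  have hu (a : RatFunc K) (ha : a ≠ 0) : IsUnit (C a) := isUnit_C.mpr (isUnit_iff_ne_zero.mpr ha)
  have h1 := (associated_unit_mul_left (q.primPart.map (algebraMap K[X] (RatFunc K))) _ (hu _ hc0))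
  have h2 := (associated_unit_mul_left s _ (hu _ hb0))
  rw [hbs'] at h1
  exact h1.symm.trans h2

variable [CharZero K]

/-- The separable part of `P`. -/
theorem exists_separable_part (P : K[X][X]) (hP : P ≠ 0) :
    ∃ p : K[X][X], p ∣ P ∧ (p.map (algebraMap K[X] (RatFunc K))).Separable ∧
      ∀ y : AlgFun K, aeval y p = 0 ↔ aeval y P = 0 := by
  have hP' : P.map (algebraMap K[X] (RatFunc K)) ≠ 0 :=
    (Polynomial.map_ne_zero_iff (IsFractionRing.injective K[X] (RatFunc K))).mpr hP
  obtain ⟨s, m, hsq, hsP, hPs⟩ := exists_squarefree_dvd_pow_of_ne_zero hP'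
  obtain ⟨p, hp, hps⟩ := exists_isPrimitive_map_associated s (ne_zero_of_dvd_ne_zero hP' hsP)
  have hsep : s.Separable := PerfectField.separable_iff_squarefree.mpr hsq
  refine ⟨p, ?_, ?_, fun y => ?_⟩
  · exact hp.dvd_of_fraction_map_dvd_fraction_map (hps.dvd.trans hsP)
  · exact hsep.of_dvd hps.dvd
  · rw [← aeval_map_algebraMap (RatFunc K) y p, ← aeval_map_algebraMap (RatFunc K) y P]
    constructor
    · intro h
      have h1 : aeval y s = 0 := zero_dvd_iff.mp (h ▸ map_dvd (aeval y) hps.dvd)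
      exact zero_dvd_iff.mp (h1 ▸ map_dvd (aeval y) hsP)
    · intro h
      have h1 : aeval y (s ^ m) = 0 := zero_dvd_iff.mp (h ▸ map_dvd (aeval y) hPs)
      rw [map_pow] at h1
      have h2 := eq_zero_of_pow_eq_zero h1
      exact zero_dvd_iff.mp (h2 ▸ map_dvd (aeval y) hps.symm.dvd)

end SquarefreePart

/-! ### Extending derivations, and embedding the algebraic functions. -/

section Extension

theorem exists_derivation_extension {K L : Type*} [Field K] [Field L] [CharZero L] [Algebra K L]
    (d : Derivation K L L) :
    ∃ D : Derivation K (AlgebraicClosure L) (AlgebraicClosure L),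
      ∀ a, D (algebraMap L _ a) = algebraMap L _ (d a) := by
  have : Algebra.FormallyEtale L (AlgebraicClosure L) := Algebra.FormallyEtale.of_isSeparable _ _
  let d' : Derivation K L (AlgebraicClosure L) :=
    (Algebra.linearMap L (AlgebraicClosure L)).compDer d
  refine ⟨(((d'.liftKaehlerDifferential.liftBaseChange (AlgebraicClosure L)).comp
    (KaehlerDifferential.tensorKaehlerEquivOfFormallyEtale
      K L (AlgebraicClosure L)).symm.toLinearMap).compDer
      (KaehlerDifferential.D K (AlgebraicClosure L))), fun a => ?_⟩
  change (LinearMap.liftBaseChange (AlgebraicClosure L) _)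
    ((KaehlerDifferential.tensorKaehlerEquivOfFormallyEtale K L (AlgebraicClosure L)).symm
      (KaehlerDifferential.D K (AlgebraicClosure L) (algebraMap L (AlgebraicClosure L) a))) = _
  rw [KaehlerDifferential.tensorKaehlerEquivOfFormallyEtale_symm_D_algebraMap]
  simp [d']

variable {K W : Type*} [Field K] [Field W] [Algebra K[X] W]

/-- An embedding of the algebraic functions over `K[x]` commutes with the derivations. -/
theorem derivation_comp_eq [CharZero K] (τ : AlgFun K →+* W)
    (hτ : ∀ f, τ (algebraMap K[X] (AlgFun K) f) = algebraMap K[X] W f) {S : Type*} [CommRing S]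
    [Algebra S W] (D : Derivation S W W)
    (hD : ∀ f, D (algebraMap K[X] W f) = algebraMap K[X] W (derivative f)) (a : AlgFun K) :
    D (τ a) = τ (algDeriv K a) := by
  let : Module (AlgFun K) W := Module.compHom W τ
  have hsmul (a : AlgFun K) (z : W) : a • z = τ a * z := rfl
  have : IsScalarTower K[X] (AlgFun K) W := ⟨fun f a z => by
    rw [hsmul, hsmul, Algebra.smul_def, Algebra.smul_def, map_mul, hτ, mul_assoc]⟩
  let G : Derivation K[X] (AlgFun K) W := Derivation.mk'
    { toFun := fun a => D (τ a) - τ (algDeriv K a)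
      map_add' := fun a b => by simp only [map_add]; ring
      map_smul' := fun f a => by
        simp only [RingHom.id_apply, Algebra.smul_def, map_mul, hτ, Derivation.leibniz, hD,
          Algebra.algebraMap_self,
          algDeriv_algebraMap, map_add]
        ring }
    (fun a b => by
      change D (τ (a * b)) - τ (algDeriv K (a * b)) = τ a * (D (τ b) - τ (algDeriv K b)) +
        τ b * (D (τ a) - τ (algDeriv K a))
      simp only [map_mul, Derivation.leibniz, smul_eq_mul, map_add]
      ring)
  -- The defect `G` of commutation is `K[x]`-linear, and a derivation over `K[x]` vanishes on the
  -- formally étale extension `AlgFun K`.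
  have hG : G = 0 := by
    rw [← G.liftKaehlerDifferential_comp, Subsingleton.elim G.liftKaehlerDifferential 0]
    ext; simp
  exact sub_eq_zero.mp (congrArg (fun d : Derivation K[X] (AlgFun K) W => d a) hG)

theorem exists_embedding [IsAlgClosed W] (hinj : Function.Injective (algebraMap K[X] W)) :
    ∃ τ : AlgFun K →+* W, ∀ f, τ (algebraMap K[X] (AlgFun K) f) = algebraMap K[X] W f := by
  let : Algebra (RatFunc K) W := (IsFractionRing.lift (K := RatFunc K) hinj).toAlgebra
  let τ : AlgFun K →ₐ[RatFunc K] W := IsAlgClosed.lift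
  refine ⟨τ.toRingHom, fun f => ?_⟩
  rw [IsScalarTower.algebraMap_apply K[X] (RatFunc K) (AlgFun K)]
  refine (τ.commutes _).trans ?_
  exact IsFractionRing.lift_algebraMap hinj f

theorem map_iterate_of_comm {A B : Type*} {f : A → B} {D : A → A} {D' : B → B}
    (h : ∀ a, D' (f a) = f (D a)) (k : ℕ) (a : A) : D'^[k] (f a) = f (D^[k] a) :=
  (Function.Semiconj.iterate_right (f := f) (fun a => (h a).symm) k a).symm

/-- Differential operators commute with embeddings of differential algebras. -/
theorem applyOp_map {A B : Type*} [CommRing A] [CommRing B] [Algebra K[X] A] [Algebra K[X] B]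
    {f : A →+* B} (hf : ∀ g, f (algebraMap K[X] A g) = algebraMap K[X] B g) {D : A → A}
    {D' : B → B} (h : ∀ a, D' (f a) = f (D a)) (L : K[X][X]) (a : A) :
    applyOp D' L (f a) = f (applyOp D L a) := by
  simp only [applyOp, sum_def, map_sum, map_mul, hf, map_iterate_of_comm h]

theorem map_aeval_of_comm {A B : Type*} [CommRing A] [CommRing B] [Algebra K[X] A]
    [Algebra K[X] B] {τ : A →+* B} (hτ : ∀ f, τ (algebraMap K[X] A f) = algebraMap K[X] B f)
    (a : A) (p : K[X][X]) : aeval (τ a) p = τ (aeval a p) := by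
  rw [aeval_def, aeval_def, hom_eval₂]
  congr 1
  exact RingHom.ext fun f => (hτ f).symm

end Extension

/-! ### The derivation of Laurent series. -/

section Laurent

variable {F : Type*} [Field F]

theorem coeff_hasseDeriv_one (f : F⸨X⸩) (n : ℤ) :
    (LaurentSeries.hasseDeriv F 1 f).coeff n = (n + 1 : ℤ) * f.coeff (n + 1) := by
  rw [LaurentSeries.hasseDeriv_coeff, Nat.cast_one, Ring.choose_one_right, zsmul_eq_mul]

theorem coeff_single_one_mul_hasseDeriv (f : F⸨X⸩) (n : ℤ) :
    (HahnSeries.single (1 : ℤ) (1 : F) * LaurentSeries.hasseDeriv F 1 f).coeff n =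
      n * f.coeff n := by
  have h := HahnSeries.coeff_single_mul_add (r := (1 : F))
    (x := LaurentSeries.hasseDeriv F 1 f) (a := n - 1) (b := 1)
  rw [sub_add_cancel, one_mul, coeff_hasseDeriv_one, sub_add_cancel] at h
  exact h

/-- The rule is checked for the Euler operator `x d/dx`, which multiplies the coefficient of index
`n` by `n`: it does not enlarge supports, so all products are sums over the same index set and the
claim is `n = i + j`. -/
theorem hasseDeriv_one_mul (f g : F⸨X⸩) :
    LaurentSeries.hasseDeriv F 1 (f * g) =
      f * LaurentSeries.hasseDeriv F 1 g + g * LaurentSeries.hasseDeriv F 1 f := by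
  set D : F⸨X⸩ →ₗ[F] F⸨X⸩ := LaurentSeries.hasseDeriv (V := F) F 1 with hD
  set x : F⸨X⸩ := HahnSeries.single (1 : ℤ) (1 : F) with hx
  have hx0 : x ≠ 0 := HahnSeries.single_ne_zero one_ne_zero
  have hsupp (f : F⸨X⸩) : (x * D f).support ⊆ f.support := fun n hn h0 => hn <| by
    rw [hx, hD, coeff_single_one_mul_hasseDeriv, h0, mul_zero]
  apply mul_left_cancel₀ hx0
  rw [show x * (f * D g + g * D f) = f * (x * D g) + (x * D f) * g by ring]
  ext n
  rw [coeff_single_one_mul_hasseDeriv, HahnSeries.coeff_add, HahnSeries.coeff_mul,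
    HahnSeries.coeff_mul_right' g.isPWO_support (hsupp g),
    HahnSeries.coeff_mul_left' f.isPWO_support (hsupp f), ← Finset.sum_add_distrib, Finset.mul_sum]
  refine Finset.sum_congr rfl fun ij hij => ?_
  rw [coeff_single_one_mul_hasseDeriv, coeff_single_one_mul_hasseDeriv,
    ← (Finset.mem_antidiagonal.mp hij).2.2]
  push_cast
  ring

theorem coeff_algebraMap_polynomial {K : Type*} [Field K] [Algebra K F] (f : K[X]) (n : ℕ) :
    (algebraMap K[X] F⸨X⸩ f).coeff n = algebraMap K F (f.coeff n) := by
  rw [HahnSeries.algebraMap_apply', PowerSeries.algebraMap_apply',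
    LaurentSeries.coeff_coe_powerSeries, PowerSeries.coeff_map, Polynomial.coeff_coe]

theorem coeff_algebraMap_polynomial_of_neg {K : Type*} [Field K] [Algebra K F] (f : K[X]) {n : ℤ}
    (hn : n < 0) : (algebraMap K[X] F⸨X⸩ f).coeff n = 0 := by
  rw [HahnSeries.algebraMap_apply', PowerSeries.coeff_coe, if_pos hn]

theorem hasseDeriv_one_algebraMap {K : Type*} [Field K] [Algebra K F] (f : K[X]) :
    LaurentSeries.hasseDeriv F 1 (algebraMap K[X] F⸨X⸩ f) =
      algebraMap K[X] F⸨X⸩ (derivative f) := by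
  ext n
  rw [coeff_hasseDeriv_one]
  rcases lt_or_ge n 0 with hn | hn
  · rw [coeff_algebraMap_polynomial_of_neg _ hn]
    rcases lt_or_ge (n + 1) 0 with hn' | hn'
    · rw [coeff_algebraMap_polynomial_of_neg _ hn', mul_zero]
    · rw [show n + 1 = 0 by omega, Int.cast_zero, zero_mul]
  · lift n to ℕ using hn
    have h := coeff_algebraMap_polynomial (F := F) f (n + 1)
    push_cast at h
    rw [h, coeff_algebraMap_polynomial, coeff_derivative]
    push_cast [map_mul, map_add, map_natCast, map_one]
    ring

theorem coeff_iterate_hasseDeriv_one_eq_zero {f : F⸨X⸩} {a : ℤ} (hf : ∀ n < a, f.coeff n = 0)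
    (k : ℕ) : ∀ n < a - k, ((LaurentSeries.hasseDeriv F 1)^[k] f).coeff n = 0 := by
  induction k with
  | zero => simpa using hf
  | succ k ih =>
    intro n hn
    rw [Function.iterate_succ_apply', coeff_hasseDeriv_one, ih _ (by push_cast at hn; omega),
      mul_zero]

theorem eq_C_of_hasseDeriv_one_eq_zero [CharZero F] {f : F⸨X⸩}
    (hf : LaurentSeries.hasseDeriv F 1 f = 0) : f = HahnSeries.C (f.coeff 0) := by
  ext n
  rcases eq_or_ne n 0 with rfl | hn
  · simp
  · have h := coeff_hasseDeriv_one f (n - 1)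
    rw [hf, sub_add_cancel, HahnSeries.coeff_zero, eq_comm, mul_eq_zero, Int.cast_eq_zero] at h
    rw [h.resolve_left hn, HahnSeries.C_apply, HahnSeries.coeff_single_of_ne hn]

end Laurent

/-! ### Extension of the `x`-adic valuation. -/

section ExtendValuation

variable {F W : Type*} [Field F] [Field W] [Algebra F⸨X⸩ W]

/-- The `x`-adic valuation extends to every extension field of `F((x))`. -/
theorem exists_valuationSubring : ∃ A : ValuationSubring W,
    (∀ f : PowerSeries F, A.valuation (algebraMap F⸨X⸩ W f) ≤ 1) ∧
    A.valuation (algebraMap F⸨X⸩ W (HahnSeries.single 1 1)) < 1 := by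
  let φ : PowerSeries F →+* W := (algebraMap F⸨X⸩ W).comp (HahnSeries.ofPowerSeries ℤ F)
  obtain ⟨A, hA⟩ := (LocalSubring.range φ).exists_le_valuationSubring
  have hmem (f : PowerSeries F) : φ f ∈ A := hA.1 ⟨f, rfl⟩
  refine ⟨A, fun f => (A.valuation_le_one_iff _).mpr (hmem f), ?_⟩
  have hX : φ PowerSeries.X = algebraMap F⸨X⸩ W (HahnSeries.single 1 1) := by
    simp [φ]
  rw [← hX]
  refine (A.valuation_lt_one_iff ⟨_, hmem _⟩).mp ?_
  rw [IsLocalRing.mem_maximalIdeal, mem_nonunits_iff]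
  intro hu
  have := hA.2
  obtain ⟨⟨_, f, rfl⟩, hf⟩ := (hA.2.map_nonunit ⟨φ PowerSeries.X, ⟨_, rfl⟩⟩ hu).exists_right_inv
  have hφ : Function.Injective φ :=
    (algebraMap F⸨X⸩ W).injective.comp HahnSeries.ofPowerSeries_injective
  refine PowerSeries.X_prime.not_isUnit (IsUnit.of_mul_eq_one f (hφ ?_))
  rw [map_mul, map_one]
  exact congrArg Subtype.val hf

end ExtendValuation

/-! ### The extended valuation in terms of the order of a series. -/

section ValuationOrder

variable {F W Γ : Type*} [Field F] [Field W] [Algebra F⸨X⸩ W] [LinearOrderedCommGroupWithZero Γ]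
  {v : Valuation W Γ}

theorem map_powerSeries_eq_one (hv : ∀ f : PowerSeries F, v (algebraMap F⸨X⸩ W f) ≤ 1)
    {f : PowerSeries F} (hf : f.constantCoeff ≠ 0) : v (algebraMap F⸨X⸩ W f) = 1 := by
  refine le_antisymm (hv f) ?_
  obtain ⟨g, hg⟩ := (PowerSeries.isUnit_iff_constantCoeff.mpr
    (isUnit_iff_ne_zero.mpr hf)).exists_right_inv
  have h : v (algebraMap F⸨X⸩ W f) * v (algebraMap F⸨X⸩ W g) = 1 := by
    rw [← map_mul, ← map_mul, ← PowerSeries.coe_mul, hg, PowerSeries.coe_one, map_one, map_one]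
  by_contra! hlt
  exact (mul_lt_one_of_lt_of_le hlt (hv g)).ne h

theorem map_single_ne_zero : v (algebraMap F⸨X⸩ W (HahnSeries.single 1 1)) ≠ 0 := by
  rw [Valuation.ne_zero_iff, map_ne_zero_iff _ (algebraMap F⸨X⸩ W).injective]
  exact HahnSeries.single_ne_zero one_ne_zero

theorem map_single (n : ℤ) : v (algebraMap F⸨X⸩ W (HahnSeries.single n 1)) =
    v (algebraMap F⸨X⸩ W (HahnSeries.single 1 1)) ^ n := by
  rw [RatFunc.single_zpow, map_zpow₀, map_zpow₀]

theorem map_eq_zpow_order (hv : ∀ f : PowerSeries F, v (algebraMap F⸨X⸩ W f) ≤ 1) {f : F⸨X⸩}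
    (hf : f ≠ 0) :
    v (algebraMap F⸨X⸩ W f) = v (algebraMap F⸨X⸩ W (HahnSeries.single 1 1)) ^ f.order := by
  conv_lhs => rw [← LaurentSeries.single_order_mul_powerSeriesPart f]
  rw [map_mul, map_mul, map_single, map_powerSeries_eq_one hv, mul_one]
  rw [← PowerSeries.coeff_zero_eq_constantCoeff_apply, LaurentSeries.powerSeriesPart_coeff]
  simpa using hf

theorem map_le_zpow (hv : ∀ f : PowerSeries F, v (algebraMap F⸨X⸩ W f) ≤ 1)
    (hX : v (algebraMap F⸨X⸩ W (HahnSeries.single 1 1)) < 1) {f : F⸨X⸩} {a : ℤ}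
    (ha : ∀ n < a, f.coeff n = 0) :
    v (algebraMap F⸨X⸩ W f) ≤ v (algebraMap F⸨X⸩ W (HahnSeries.single 1 1)) ^ a := by
  rcases eq_or_ne f 0 with rfl | hf
  · rw [map_zero, map_zero]
    exact zero_le
  · rw [map_eq_zpow_order hv hf]
    refine zpow_le_zpow_right_of_le_one₀ (zero_lt_iff.mpr map_single_ne_zero) hX.le ?_
    by_contra! h
    exact hf (HahnSeries.coeff_order_eq_zero.mp (ha _ h))

end ValuationOrder

/-! ### Constants of an algebraic extension. -/

section Constants

variable {S L W Γ : Type*} [CommRing S] [Field L] [Field W] [Algebra L W] [Algebra S W]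
  [Algebra.IsAlgebraic L W] [LinearOrderedCommGroupWithZero Γ]

/-- An algebraic element with derivative zero is algebraic over the constants. -/
theorem derivation_coeff_minpoly_eq_zero {D : Derivation S W W} {δ : L → L}
    (hD : ∀ a, D (algebraMap L W a) = algebraMap L W (δ a)) {c : W} (hc : D c = 0) (i : ℕ) :
    δ ((minpoly L c).coeff i) = 0 := by
  have hδ0 : δ 0 = 0 := (algebraMap L W).injective (by rw [← hD, map_zero, map_zero])
  have hδ1 : δ 1 = 0 := (algebraMap L W).injective (by rw [← hD, map_one, D.map_one_eq_zero, map_zero])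
  have hint : IsIntegral L c := Algebra.IsIntegral.isIntegral c
  have hpow (k : ℕ) : D (c ^ k) = 0 := by rw [D.leibniz_pow, hc, smul_zero, smul_zero]
  set q : L[X] := ∑ i ∈ Finset.range (minpoly L c).natDegree, C (δ ((minpoly L c).coeff i)) * X ^ i
    with hq
  have hcoeff (i : ℕ) : q.coeff i = δ ((minpoly L c).coeff i) := by
    simp only [hq, finsetSum_coeff, coeff_C_mul_X_pow, Finset.sum_ite_eq, Finset.mem_range]
    split_ifs with h
    · rfl
    · rcases (not_lt.mp h).eq_or_lt with h | h
      · rw [← h, (minpoly.monic hint).coeff_natDegree, hδ1]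
      · rw [coeff_eq_zero_of_natDegree_lt h, hδ0]
  -- Differentiating the minimal relation of the constant `c` gives a relation of smaller degree,
  -- since the leading coefficient is `1`; minimality makes it trivial.
  have hq0 : aeval c q = 0 := by
    have h := congrArg D (minpoly.aeval L c)
    rw [aeval_eq_sum_range, Finset.sum_range_succ, (minpoly.monic hint).coeff_natDegree, one_smul,
      map_add, hpow, add_zero, map_sum, map_zero] at h
    rw [hq, map_sum, ← h]
    refine Finset.sum_congr rfl fun i _ => ?_
    rw [Algebra.smul_def, D.leibniz, hpow, smul_zero, zero_add, hD, map_mul, aeval_C, map_pow,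
      aeval_X, smul_eq_mul, mul_comm]
  rw [← hcoeff]
  by_contra h
  have hne : q ≠ 0 := fun h0 => h (by rw [h0, coeff_zero])
  refine (minpoly.degree_le_of_ne_zero L c hne hq0).not_gt ?_
  rw [degree_eq_natDegree (minpoly.ne_zero hint)]
  refine (degree_lt_iff_coeff_zero _ _).mpr fun m hm => ?_
  rw [hcoeff]
  rcases hm.eq_or_lt with h | h
  · rw [← h, (minpoly.monic hint).coeff_natDegree, hδ1]
  · rw [coeff_eq_zero_of_natDegree_lt h, hδ0]

/-- A constant is integral over the constants of `L`, on which `v ≤ 1`; if `v c > 1`, the leading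
term of its minimal equation would dominate strictly. -/
theorem map_le_one_of_derivation_eq_zero {D : Derivation S W W} {δ : L → L}
    (hD : ∀ a, D (algebraMap L W a) = algebraMap L W (δ a)) {v : Valuation W Γ}
    (hv : ∀ a, δ a = 0 → v (algebraMap L W a) ≤ 1) {c : W} (hc : D c = 0) : v c ≤ 1 := by
  by_contra! hlt
  have hint : IsIntegral L c := Algebra.IsIntegral.isIntegral c
  have hc0 : 0 < v c := zero_lt_one.trans hlt
  have h := minpoly.aeval L c
  rw [aeval_eq_sum_range, Finset.sum_range_succ, (minpoly.monic hint).coeff_natDegree, one_smul]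
    at h
  rw [add_eq_zero_iff_neg_eq] at h
  have h2 : v (c ^ (minpoly L c).natDegree) < v (c ^ (minpoly L c).natDegree) := by
    conv_lhs => rw [← h, Valuation.map_neg]
    refine v.map_sum_lt (v.ne_zero_iff.mpr (pow_ne_zero _ (v.ne_zero_iff.mp hc0.ne'))) fun i hi => ?_
    rw [Algebra.smul_def, map_mul, map_pow, map_pow]
    refine (mul_le_of_le_one_left zero_le
      (hv _ (derivation_coeff_minpoly_eq_zero hD hc i))).trans_lt ?_
    exact pow_lt_pow_right₀ hlt (Finset.mem_range.mp hi)
  exact h2.false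

end Constants

/-! ### From resolvents to systems of simple roots. -/

section Resolvents

variable {K : Type*} [Field K] [CharZero K]

theorem algebraMap_algFun_injective (K : Type*) [Field K] :
    Function.Injective (algebraMap K[X] (AlgFun K)) := by
  rw [IsScalarTower.algebraMap_eq K[X] (RatFunc K) (AlgFun K)]
  exact (algebraMap (RatFunc K) (AlgFun K)).injective.comp
    (IsFractionRing.injective K[X] (RatFunc K))

/-- Testing on `x^i` isolates the coefficient of `∂^i` once the lower ones are known to vanish. This
excludes `P = 0` for a resolvent. -/
theorem eq_zero_of_cancels_all {L : K[X][X]} (h : ∀ y, applyOp (algDeriv K) L y = 0) : L = 0 := by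
  ext1 i
  rw [coeff_zero]
  induction i using Nat.strong_induction_on with
  | _ i ih =>
    have h1 := h (algebraMap K[X] (AlgFun K) (X ^ i))
    simp only [applyOp, sum_def, map_iterate_of_comm (algDeriv_algebraMap K), ← map_mul, ← map_sum,
      iterate_derivative_X_pow_eq_natCast_mul] at h1
    rw [map_eq_zero_iff _ (algebraMap_algFun_injective K),
      Finset.sum_eq_single i] at h1
    · simpa [Nat.descFactorial_self, Nat.factorial_ne_zero] using h1
    · intro j _ hj
      rcases hj.lt_or_gt with hj | hj
      · rw [ih j hj, zero_mul]
      · rw [Nat.descFactorial_of_lt hj, Nat.cast_zero, zero_mul, mul_zero]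
    · intro hi
      rw [notMem_support_iff.mp hi, zero_mul]

theorem IsResolvent.ne_zero_right {L P : K[X][X]} (h : IsResolvent L P) : P ≠ 0 := by
  rintro rfl
  exact h.ne_zero (eq_zero_of_cancels_all fun y => h.cancels y (map_zero _))

theorem IsResolvent.natDegree_eq_zero {L P : K[X][X]} (h : IsResolvent L P)
    (hP : ∀ y : AlgFun K, aeval y P ≠ 0) : L.natDegree = 0 := by
  have h1 := h.order_le 1 one_ne_zero fun y hy => absurd hy (hP y)
  rwa [natDegree_one, Nat.le_zero] at h1

theorem abs_order_le_of_isResolvent {L Γ : Type*} [Field L] [CharZero L] [Algebra K[X] L]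
    [LinearOrderedCommGroupWithZero Γ] {v : Valuation (AlgebraicClosure L) Γ} {T : Γ}
    (δ : L →+ L) (hmul : ∀ a b, δ (a * b) = a * δ b + b * δ a)
    (hδ : ∀ f, δ (algebraMap K[X] L f) = algebraMap K[X] L (derivative f)) (hT : 1 < T)
    (hle : ∀ f : K[X], v (algebraMap L _ (algebraMap K[X] L f)) ≤ 1)
    (hge : ∀ f : K[X], f ≠ 0 → 1 ≤ v (algebraMap L _ (algebraMap K[X] L f)) * T ^ f.natDegree)
    (hconst : ∀ a, δ a = 0 → v (algebraMap L _ a) ≤ 1) {P M : K[X][X]} {dx dy : ℕ}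
    (hdx : ∀ i, (P.coeff i).natDegree ≤ dx) (hdy : P.natDegree ≤ dy) (hM : IsResolvent M P)
    {y : L} (hy0 : y ≠ 0) (hy : applyOp δ M y = 0) {m : ℤ}
    (hm : v (algebraMap L _ y) = T ^ (-m))
    (hmk : ∀ k : ℕ, v (algebraMap L _ (δ^[k] y)) ≤ T ^ ((k : ℤ) - m)) :
    |m| ≤ 11 * dx * dy ^ 2 := by
  let : Algebra K L := ((algebraMap K[X] L).comp C).toAlgebra
  have : IsScalarTower K K[X] L := .of_algebraMap_eq fun _ => rfl
  let d : Derivation K L L := Derivation.mk'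
    { toFun := δ
      map_add' := map_add δ
      map_smul' := fun c a => by
        rw [RingHom.id_apply, Algebra.smul_def, Algebra.smul_def, hmul,
          IsScalarTower.algebraMap_apply K K[X] L, hδ, algebraMap_eq, derivative_C, map_zero,
          mul_zero, add_zero] }
    hmul
  obtain ⟨D, hD⟩ := exists_derivation_extension d
  change ∀ a, D (algebraMap L (AlgebraicClosure L) a) = algebraMap L _ (δ a) at hD
  have htower (f : K[X]) : algebraMap L (AlgebraicClosure L) (algebraMap K[X] L f) =
    algebraMap K[X] (AlgebraicClosure L) f := rfl
  have hDf (f : K[X]) : D (algebraMap K[X] (AlgebraicClosure L) f) =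
      algebraMap K[X] (AlgebraicClosure L) (derivative f) := by
    rw [← htower, hD, hδ, htower]
  have hgrowth : IsGrowth D v T := ⟨hT, hle, hge, fun c hc =>
    map_le_one_of_derivation_eq_zero hD hconst hc⟩
  have hinj : Function.Injective (algebraMap K[X] (AlgebraicClosure L)) := by
    rw [injective_iff_map_eq_zero]
    intro f hf
    by_contra hf0
    have h1 := hge f hf0
    rw [htower, hf, map_zero, zero_mul] at h1
    exact h1.not_gt zero_lt_one
  have hinj' : Function.Injective (algebraMap K[X] L) := fun f g hfg =>
    hinj (by rw [← htower, ← htower, hfg])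
  have hP := hM.ne_zero_right
  obtain ⟨p, hpP, hsep, hroots⟩ := exists_separable_part P hP
  have hp0 : p ≠ 0 := ne_zero_of_dvd_ne_zero hP hpP
  -- If `P` had no roots, its resolvent would have order zero, hence no nonzero solution.
  have hn : 0 < p.natDegree := by
    rw [Nat.pos_iff_ne_zero]
    intro h0
    have hM0 := hM.natDegree_eq_zero fun a ha => by
      rw [← hroots, eq_C_of_natDegree_eq_zero h0, aeval_C,
        map_eq_zero_iff _ (algebraMap_algFun_injective K)] at ha
      rw [eq_C_of_natDegree_eq_zero h0, ha, C_0] at hp0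
      exact hp0 rfl
    have hMne := hM.ne_zero
    rw [eq_C_of_natDegree_eq_zero hM0] at hy hMne
    rw [applyOp, sum_C_index (by rw [map_zero, zero_mul]), Function.iterate_zero_apply,
      mul_eq_zero, map_eq_zero_iff _ hinj'] at hy
    exact hMne (by rw [hy.resolve_right hy0, C_0])
  obtain ⟨τ, hτ⟩ := exists_embedding hinj
  have hcomm := derivation_comp_eq τ hτ D hDf
  have hmem (a : AlgFun K) :
      a ∈ (p.map (algebraMap K[X] (RatFunc K))).rootSet (AlgFun K) ↔ aeval a P = 0 := by
    rw [mem_rootSet, aeval_map_algebraMap, hroots]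
    exact and_iff_right hsep.ne_zero
  let α : (p.map (algebraMap K[X] (RatFunc K))).rootSet (AlgFun K) → AlgebraicClosure L :=
    fun a => τ a
  have hα : SimpleRoots p dx α :=
    { algebraMap_injective := hinj
      natDegree_coeff_le := natDegree_coeff_le_of_dvd hpP hP hdx
      injective := τ.injective.comp Subtype.val_injective
      card_eq := by
        rw [card_rootSet_eq_natDegree hsep (IsAlgClosed.splits _),
          natDegree_map_eq_of_injective (IsFractionRing.injective K[X] (RatFunc K))]
      ne_zero := hp0
      root := fun a => by
        rw [map_aeval_of_comm hτ, (hroots _).mpr ((hmem _).mp a.2), map_zero] }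
  classical
  have key := hα.exponent_bounds hgrowth (by rw [hDf, derivative_X, map_one]) hn hM.ne_zero
    (fun a => by
      rw [applyOp_map hτ hcomm, hM.cancels _ ((hmem _).mp a.2), map_zero])
    (fun N hN hNα => hM.order_le N hN fun a ha => τ.injective <| by
      rw [← applyOp_map hτ hcomm, map_zero]
      exact hNα ⟨a, (hmem a).mpr ha⟩)
    (y := algebraMap L _ y)
    ((map_ne_zero_iff _ (algebraMap L (AlgebraicClosure L)).injective).mpr hy0)
    (by rw [applyOp_map htower hD, hy, map_zero]) hm
    (fun k => by rw [map_iterate_of_comm hD]; exact hmk k)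
  have hdeg : p.natDegree ≤ dy := (natDegree_le_of_dvd hpP hP).trans hdy
  have hbound : (11 * dx * p.natDegree ^ 2 : ℤ) ≤ 11 * dx * dy ^ 2 := by
    gcongr
  have hbound' : (dx : ℤ) ≤ 11 * dx * dy ^ 2 := by
    have h1 : 1 ≤ dy ^ 2 := Nat.one_le_pow _ _ (hn.trans_le hdeg)
    have h2 : dx ≤ 11 * dx * dy ^ 2 := by nlinarith
    exact_mod_cast h2
  exact abs_le.mpr ⟨by linarith [key.1], key.2.trans hbound⟩

end Resolvents

/-! ### The case of Laurent series, with `T = v(x)⁻¹`. -/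

section LaurentBound

theorem abs_order_le_of_isLaurentSolution {K F : Type*} [Field K] [CharZero K] [Field F]
    [Algebra K F] {P L : K[X][X]} {dx dy : ℕ} (hdx : ∀ i, (P.coeff i).natDegree ≤ dx)
    (hdy : P.natDegree ≤ dy) (hL : IsResolvent L P) {y : F⸨X⸩} (hy0 : y ≠ 0)
    (hy : IsLaurentSolution L y) : |y.order| ≤ 11 * dx * dy ^ 2 := by
  have : CharZero F := charZero_of_injective_algebraMap (algebraMap K F).injective
  have : CharZero F⸨X⸩ :=
    charZero_of_injective_ringHom (f := (HahnSeries.C : F →+* F⸨X⸩)) HahnSeries.C_injective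
  obtain ⟨A, hA, hX⟩ := exists_valuationSubring (F := F) (W := AlgebraicClosure F⸨X⸩)
  set v := A.valuation
  set t := v (algebraMap F⸨X⸩ _ (HahnSeries.single 1 1)) with ht
  have ht0 : t ≠ 0 := map_single_ne_zero
  have hpoly (f : K[X]) : algebraMap K[X] F⸨X⸩ f =
    ((algebraMap K[X] (PowerSeries F) f : PowerSeries F) : F⸨X⸩) := HahnSeries.algebraMap_apply' ℤ f
  have hdom : 1 < t⁻¹ := (one_lt_inv₀ (zero_lt_iff.mpr ht0)).mpr hX
  refine abs_order_le_of_isResolvent (v := v) (T := t⁻¹)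
    (LaurentSeries.hasseDeriv (V := F) F 1).toAddMonoidHom hasseDeriv_one_mul
    hasseDeriv_one_algebraMap hdom ?_ ?_ ?_ hdx hdy hL hy0 hy ?_ ?_
  · intro f
    rw [hpoly]
    exact hA _
  · intro f hf
    have hne : (algebraMap K[X] F⸨X⸩ f).coeff (f.natDegree : ℤ) ≠ 0 := by
      rw [coeff_algebraMap_polynomial, map_ne_zero_iff _ (algebraMap K F).injective]
      exact leadingCoeff_ne_zero.mpr hf
    have hne0 : algebraMap K[X] F⸨X⸩ f ≠ 0 := fun h0 => hne (by rw [h0, HahnSeries.coeff_zero])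
    rw [map_eq_zpow_order hA hne0, ← ht, ← inv_inv t, inv_zpow', inv_inv, ← zpow_natCast,
      ← zpow_add₀ (inv_ne_zero ht0)]
    refine one_le_zpow₀ hdom.le ?_
    linarith [HahnSeries.order_le_of_coeff_ne_zero hne]
  · intro a ha
    rw [eq_C_of_hasseDeriv_one_eq_zero ha, ← PowerSeries.coe_C]
    exact hA _
  · rw [map_eq_zpow_order hA hy0, ← ht, inv_zpow', neg_neg]
  · intro k
    rw [inv_zpow', neg_sub]
    exact map_le_zpow hA hX (coeff_iterate_hasseDeriv_one_eq_zero
      (fun n hn => HahnSeries.coeff_eq_zero_of_lt_order hn) k)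

end LaurentBound

end Resolvent

end

theorem mainTheorem7 :
    ∃ C : ℕ, ∀ (K : Type*) [Field K] [CharZero K] (F : Type*) [Field F] [Algebra K F]
      (P L : Polynomial (Polynomial K)) (dx dy : ℕ),
      (∀ i, (P.coeff i).natDegree ≤ dx) → P.natDegree ≤ dy →
      Resolvent.IsResolvent L P →
      ∀ y : LaurentSeries F, y ≠ 0 → Resolvent.IsLaurentSolution L y →
        |y.order| ≤ (C : ℤ) * dx * dy ^ 2 :=
  ⟨11, fun _ _ _ _ _ _ _ _ _ _ hdx hdy hL _ hy0 hy =>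
    Resolvent.abs_order_le_of_isLaurentSolution hdx hdy hL hy0 hy⟩
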